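/- Let $\mathbb K$ be $\mathbb R$ or $\mathbb C$, let $n$ be a natural number and let $E$ be a Banach space over $\mathbb K$ with bidual $E''$. Let $\mathcal P^n(E)$ be the space of continuous scalar-valued $n$-homogeneous polynomials on $E$. The Aron--Berner extension $AB(P)\in\mathcal P^n(E'')$ of $P\in\mathcal P^n(E)$ with associated symmetric $n$-linear form $A$ is $AB(P)(z)=\widetilde A(z,\dots,z)$, where $\widetilde A$ is obtained from $A$ by extending the variables to $E''$ one after the other, from the last to the first, by weak-star continuity: $$\widetilde A(z_1,\dots,z_n)=z_1\bigl(x_1\mapsto z_2\bigl(x_2\mapsto\cdots z_n(x_n\mapsto A(x_1,\dots,x_n))\cdots\bigr)\bigr).$$ Let $\otimes^{n,s}E$ be the $n$-fold symmetric tensor product, the linear span of the powers $\otimes^n x=x\otimes\cdots\otimes x$ in $\otimes^nE$. An s-tensor norm $\alpha$ of order $n$ assigns to every Banach space $E$ a norm $\alpha(\cdot\,;\otimes^{n,s}E)$ on $\otimes^{n,s}E$ such that $\varepsilon_s\le\alpha\le\pi_s$ (the injective and the projective s-tensor norm) and $\alpha(\otimes^{n,s}T(z);\otimes^{n,s}F)\le\|T\|^n\,\alpha(z;\otimes^{n,s}E)$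 for all bounded operators $T:E\to F$ and $z\in\otimes^{n,s}E$. It is finitely generated if $\alpha(z;\otimes^{n,s}E)=\inf\{\alpha(z;\otimes^{n,s}M): M\subset E \text{ a finite-dimensional subspace},\ z\in\otimes^{n,s}M\}$ for all $E$ and $z$. Let $\widetilde\otimes^{n,s}_\alpha E$ be the completion; a functional $\varphi\in(\widetilde\otimes^{n,s}_\alpha E)'$ is identified with the polynomial $x\mapsto\varphi(\otimes^n x)$ in $\mathcal P^n(E)$. A Banach ideal $\mathcal Q$ of $n$-homogeneous polynomials assigns to every Banach space $E$ a linear subspace $\mathcal Q(E)$ of $\mathcal P^n(E)$ with a complete norm $\|\cdot\|_{\mathcal Q(E)}$ such that $P\circ T\in\mathcal Q(F)$ and $\|P\circ T\|_{\mathcal Q(F)}\le\|P\|_{\mathcal Q(E)}\|T\|^n$ for all $P\in\mathcal Q(E)$ and bounded operators $T:F\to E$, and such that $z\mapsto z^n$ belongs to $\mathcal Q(\mathbb K)$ with norm $1$. It is maximal if, for all $E$ and $P\in\mathcal P^n(E)$, one has $P\in\mathcal Q(E)$ if and only if $s(P):=\sup\{\|P|_M\|_{\mathcal Q(M)}: M\subset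 E \text{ a finite-dimensional subspace}\}<\infty$, and in that case $\|P\|_{\mathcal Q(E)}=s(P)$. Then the following hold. (a) Let $\alpha$ be a finitely generated s-tensor norm of order $n$ and let $P\in(\widetilde\otimes^{n,s}_\alpha E)'$. Then $AB(P)\in(\widetilde\otimes^{n,s}_\alpha E'')'$ and $$\|P\|_{(\widetilde\otimes^{n,s}_\alpha E)'}=\|AB(P)\|_{(\widetilde\otimes^{n,s}_\alpha E'')'}.$$ (b) Let $\mathcal Q$ be a maximal Banach ideal of $n$-homogeneous polynomials and let $P\in\mathcal Q(E)$. Then $AB(P)\in\mathcal Q(E'')$ and $$\|P\|_{\mathcal Q(E)}=\|AB(P)\|_{\mathcal Q(E'')}.$$ Thus the linear map $AB$ is an isometry from $\mathcal Q(E)$ into $\mathcal Q(E'')$. -/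

import Mathlib

open scoped TensorProduct ENNReal
open Filter Topology

universe u

noncomputable section

/-! ### Polarization -/

/-- The polarization identity for the sum of all permutations of a multilinear map. -/
theorem polarization_identity {R V W : Type*} [CommRing R] [AddCommGroup V] [Module R V]
    [AddCommGroup W] [Module R W] {n : ℕ}
    (f : MultilinearMap R (fun _ : Fin n => V) W) (x : Fin n → V) :
    ∑ σ : Equiv.Perm (Fin n), f (fun i => x (σ i)) =
      ∑ T : Finset (Fin n), (-1 : ℤ) ^ T.card • f (fun _ => ∑ i ∈ Tᶜ, x i) := by
  classical
  have h1 : ∀ T : Finset (Fin n), f (fun _ => ∑ i ∈ Tᶜ, x i) =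
      ∑ r : Fin n → Fin n, if T ⊆ (Finset.univ.image r)ᶜ then f (fun i => x (r i)) else 0 := by
    intro T
    rw [f.map_sum_finset (fun _ j => x j) (fun _ => Tᶜ), ← Finset.sum_filter]
    refine Finset.sum_congr ?_ fun _ _ => rfl
    ext r
    simp only [Fintype.mem_piFinset, Finset.mem_compl, Finset.mem_filter, Finset.mem_univ,
      true_and, Finset.subset_iff, Finset.mem_image]
    grind
  have h2 : ∀ r : Fin n → Fin n,
      ∑ T : Finset (Fin n), (-1 : ℤ) ^ T.card •
        (if T ⊆ (Finset.univ.image r)ᶜ then f (fun i => x (r i)) else 0) =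
      if Function.Bijective r then f (fun i => x (r i)) else 0 := by
    intro r
    have h3 : ∑ T : Finset (Fin n), (-1 : ℤ) ^ T.card •
        (if T ⊆ (Finset.univ.image r)ᶜ then f (fun i => x (r i)) else 0) =
        (∑ T ∈ ((Finset.univ.image r)ᶜ).powerset, (-1 : ℤ) ^ T.card) • f (fun i => x (r i)) := by
      rw [Finset.sum_smul]
      simp_rw [smul_ite, smul_zero]
      rw [← Finset.sum_filter]
      refine Finset.sum_congr ?_ fun _ _ => rfl
      ext T
      simp
    rw [h3, Finset.sum_powerset_neg_one_pow_card]
    have h4 : (Finset.univ.image r)ᶜ = ∅ ↔ Function.Bijective r := by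
      rw [← Finite.surjective_iff_bijective, Finset.compl_eq_empty_iff,
        ← Finset.coe_eq_univ, Finset.coe_image,
        Finset.coe_univ, Set.image_univ, Set.range_eq_univ]
    simp only [h4]
    split_ifs <;> simp
  simp_rw [h1, Finset.smul_sum]
  rw [Finset.sum_comm]
  simp_rw [h2]
  rw [← Finset.sum_filter]
  refine Finset.sum_bij (fun σ _ => (σ : Fin n → Fin n)) ?_ ?_ ?_ ?_
  · intro σ _
    exact Finset.mem_filter.mpr ⟨Finset.mem_univ _, σ.bijective⟩
  · intro σ _ τ _ h
    exact Equiv.coe_fn_injective h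
  · intro r hr
    exact ⟨Equiv.ofBijective r (Finset.mem_filter.mp hr).2, Finset.mem_univ _, rfl⟩
  · intro _ _
    rfl

/-! ### Continuous homogeneous polynomials -/

section Polynomials

variable (𝕜 : Type*) [RCLike 𝕜] (n : ℕ) (E : Type*) [NormedAddCommGroup E] [NormedSpace 𝕜 E]

/-- `x ↦ A (x, …, x)`, as a linear map of the continuous `n`-linear form `A`. -/
def diagonalMap : (E [×n]→L[𝕜] 𝕜) →ₗ[𝕜] (E → 𝕜) where
  toFun A x := A (fun _ => x)
  map_add' _ _ := rfl
  map_smul' _ _ := rfl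

/-- The space `𝒫ⁿ(E)` of continuous scalar valued `n`-homogeneous polynomials on `E`. -/
def HomPoly : Submodule 𝕜 (E → 𝕜) := LinearMap.range (diagonalMap 𝕜 n E)

variable {𝕜 n E}

/-- The symmetrization of a continuous `n`-linear form. -/
def symmetrize (A : E [×n]→L[𝕜] 𝕜) : E [×n]→L[𝕜] 𝕜 :=
  ((n.factorial : 𝕜)⁻¹) • ∑ σ : Equiv.Perm (Fin n), A.domDomCongr σ

theorem symmetrize_apply (A : E [×n]→L[𝕜] 𝕜) (x : Fin n → E) :
    symmetrize A x = (n.factorial : 𝕜)⁻¹ * ∑ T : Finset (Fin n),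
      (-1 : ℤ) ^ T.card • A (fun _ => ∑ i ∈ Tᶜ, x i) := by
  have h := polarization_identity A.toMultilinearMap x
  simp only [ContinuousMultilinearMap.coe_coe] at h
  rw [← h]
  simp [symmetrize, _root_.sum_apply]

/-- The symmetric continuous `n`-linear form associated with an `n`-homogeneous polynomial. -/
def HomPoly.symForm (P : HomPoly 𝕜 n E) : E [×n]→L[𝕜] 𝕜 := symmetrize P.2.choose

theorem HomPoly.symForm_apply (P : HomPoly 𝕜 n E) (x : Fin n → E) :
    HomPoly.symForm P x = (n.factorial : 𝕜)⁻¹ * ∑ T : Finset (Fin n),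
      (-1 : ℤ) ^ T.card • P.1 (∑ i ∈ Tᶜ, x i) := by
  have h : ∀ y, P.2.choose (fun _ => y) = P.1 y := fun y => congrFun P.2.choose_spec y
  simp only [HomPoly.symForm, symmetrize_apply, h]

/-- The associated form is symmetric. -/
theorem HomPoly.symForm_perm (P : HomPoly 𝕜 n E) (τ : Equiv.Perm (Fin n)) (x : Fin n → E) :
    HomPoly.symForm P (fun i => x (τ i)) = HomPoly.symForm P x := by
  simp only [HomPoly.symForm, symmetrize, _root_.smul_apply,
    _root_.sum_apply, ContinuousMultilinearMap.domDomCongr_apply]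
  congr 1
  exact Fintype.sum_equiv (Equiv.mulLeft τ) _ _ fun σ => rfl

/-- The associated form gives back the polynomial on the diagonal. -/
theorem HomPoly.symForm_diag (P : HomPoly 𝕜 n E) (x : E) :
    HomPoly.symForm P (fun _ => x) = P.1 x := by
  have h : P.2.choose (fun _ => x) = P.1 x := congrFun P.2.choose_spec x
  have h0 : (n.factorial : 𝕜) ≠ 0 := Nat.cast_ne_zero.mpr n.factorial_ne_zero
  simp [HomPoly.symForm, symmetrize, _root_.sum_apply, h, Fintype.card_perm, h0]

/-- `P ∘ T` for a continuous linear operator `T`. -/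
def HomPoly.comp {F : Type*} [NormedAddCommGroup F] [NormedSpace 𝕜 F]
    (P : HomPoly 𝕜 n E) (T : F →L[𝕜] E) : HomPoly 𝕜 n F :=
  ⟨fun y => P.1 (T y), by
    obtain ⟨A, hA⟩ := P.2
    exact ⟨A.compContinuousLinearMap fun _ => T, by rw [← hA]; rfl⟩⟩

variable (𝕜 n) in
/-- The polynomial `z ↦ zⁿ` on the scalar field. -/
def HomPoly.pow : HomPoly 𝕜 n 𝕜 :=
  ⟨fun z => z ^ n, ContinuousMultilinearMap.mkPiAlgebraFin 𝕜 n 𝕜, by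
    funext z
    simp [diagonalMap]⟩

end Polynomials

/-! ### The Aron–Berner extension -/

section AronBerner

variable {𝕜 : Type*} [RCLike 𝕜] {E : Type*} [NormedAddCommGroup E] [NormedSpace 𝕜 E]

variable (𝕜 E) in
/-- The bidual `E''`. -/
abbrev Bidual : Type _ := StrongDual 𝕜 (StrongDual 𝕜 E)

/-- The iterated extension of an `n`-linear form to the bidual. The last variable is extended
first: for fixed `x₁, …, xₙ₋₁` the functional `A (x₁, …, xₙ₋₁, ·)` extends in a unique weak-star
continuous way to `E''`, with value `zₙ (A (x₁, …, xₙ₋₁, ·))` at `zₙ`; one proceeds in the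
same way with the resulting `(n - 1)`-linear form, down to the first variable. -/
def aronBernerVal : (n : ℕ) → (E [×n]→L[𝕜] 𝕜) → (Fin n → Bidual 𝕜 E) → 𝕜
  | 0, A, _ => A 0
  | n + 1, A, z =>
      aronBernerVal n ((z (Fin.last n)).compContinuousMultilinearMap A.curryRight) (Fin.init z)

theorem aronBernerVal_add : ∀ (n : ℕ) (A B : E [×n]→L[𝕜] 𝕜) (z : Fin n → Bidual 𝕜 E),
    aronBernerVal n (A + B) z = aronBernerVal n A z + aronBernerVal n B z
  | 0, _, _, _ => rfl
  | n + 1, A, B, z => by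
      simp only [aronBernerVal]
      rw [← aronBernerVal_add n]
      congr 1
      ext m
      exact map_add (z (Fin.last n)) (A.curryRight m) (B.curryRight m)

theorem aronBernerVal_smul : ∀ (n : ℕ) (c : 𝕜) (A : E [×n]→L[𝕜] 𝕜) (z : Fin n → Bidual 𝕜 E),
    aronBernerVal n (c • A) z = c * aronBernerVal n A z
  | 0, _, _, _ => rfl
  | n + 1, c, A, z => by
      simp only [aronBernerVal]
      rw [← aronBernerVal_smul n]
      congr 1
      ext m
      exact map_smul (z (Fin.last n)) c (A.curryRight m)

theorem aronBernerVal_norm_le : ∀ (n : ℕ) (A : E [×n]→L[𝕜] 𝕜) (z : Fin n → Bidual 𝕜 E),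
    ‖aronBernerVal n A z‖ ≤ ‖A‖ * ∏ i, ‖z i‖
  | 0, A, z => by
      simp [aronBernerVal]
  | n + 1, A, z => by
      simp only [aronBernerVal]
      refine (aronBernerVal_norm_le n _ _).trans ?_
      have h := (z (Fin.last n)).norm_compContinuousMultilinearMap_le A.curryRight
      rw [A.curryRight_norm] at h
      rw [Fin.prod_univ_castSucc]
      calc _ ≤ (‖z (Fin.last n)‖ * ‖A‖) * ∏ i, ‖Fin.init z i‖ := by gcongr
        _ = _ := by simp only [Fin.init]; ring

theorem aronBernerVal_update_add : ∀ (n : ℕ) (A : E [×n]→L[𝕜] 𝕜) (z : Fin n → Bidual 𝕜 E)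
    (i : Fin n) (a b : Bidual 𝕜 E), aronBernerVal n A (Function.update z i (a + b)) =
      aronBernerVal n A (Function.update z i a) + aronBernerVal n A (Function.update z i b)
  | 0, _, _, i, _, _ => i.elim0
  | n + 1, A, z, i, a, b => by
      simp only [aronBernerVal]
      induction i using Fin.lastCases with
      | last =>
          simp only [Function.update_self, Fin.init_update_last]
          rw [← aronBernerVal_add]
          rfl
      | cast j =>
          simp only [Fin.init_update_castSucc, ne_eq, (Fin.castSucc_lt_last _).ne', not_false_eq_true,
            Function.update_of_ne]
          exact aronBernerVal_update_add n _ _ j a b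

theorem aronBernerVal_update_smul : ∀ (n : ℕ) (A : E [×n]→L[𝕜] 𝕜) (z : Fin n → Bidual 𝕜 E)
    (i : Fin n) (c : 𝕜) (a : Bidual 𝕜 E), aronBernerVal n A (Function.update z i (c • a)) =
      c • aronBernerVal n A (Function.update z i a)
  | 0, _, _, i, _, _ => i.elim0
  | n + 1, A, z, i, c, a => by
      simp only [aronBernerVal]
      induction i using Fin.lastCases with
      | last =>
          simp only [Function.update_self, Fin.init_update_last]
          rw [smul_eq_mul, ← aronBernerVal_smul]
          rfl
      | cast j =>
          simp only [Fin.init_update_castSucc, ne_eq, (Fin.castSucc_lt_last _).ne', not_false_eq_true,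
            Function.update_of_ne]
          exact aronBernerVal_update_smul n _ _ j c a

/-- The iterated extension as an `n`-linear form on `E''`. -/
def aronBernerMultilinear {n : ℕ} (A : E [×n]→L[𝕜] 𝕜) :
    MultilinearMap 𝕜 (fun _ : Fin n => Bidual 𝕜 E) 𝕜 where
  toFun := aronBernerVal n A
  map_update_add' := by
    intro inst z i a b
    rw [Subsingleton.elim inst (instDecidableEqFin n)]
    exact aronBernerVal_update_add n A z i a b
  map_update_smul' := by
    intro inst z i c a
    rw [Subsingleton.elim inst (instDecidableEqFin n)]
    exact aronBernerVal_update_smul n A z i c a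

/-- The iterated extension as a continuous `n`-linear form on `E''`. -/
def aronBernerForm {n : ℕ} (A : E [×n]→L[𝕜] 𝕜) : Bidual 𝕜 E [×n]→L[𝕜] 𝕜 :=
  MultilinearMap.mkContinuous (𝕜 := 𝕜) (E := fun _ : Fin n => Bidual 𝕜 E) (G := 𝕜)
    (aronBernerMultilinear A) ‖A‖ (aronBernerVal_norm_le n A)

/-- The Aron–Berner extension `AB : 𝒫ⁿ(E) → 𝒫ⁿ(E'')`: extend the associated symmetric form and
restrict to the diagonal. -/
def aronBerner {n : ℕ} : HomPoly 𝕜 n E →ₗ[𝕜] HomPoly 𝕜 n (Bidual 𝕜 E) where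
  toFun P := ⟨fun z => aronBernerForm (HomPoly.symForm P) (fun _ => z),
    aronBernerForm (HomPoly.symForm P), rfl⟩
  map_add' P Q := by
    have h : HomPoly.symForm (P + Q) = HomPoly.symForm P + HomPoly.symForm Q := by
      ext x
      simp only [HomPoly.symForm_apply, _root_.add_apply, Submodule.coe_add,
        Pi.add_apply, smul_add, Finset.sum_add_distrib, mul_add]
    refine Subtype.ext (funext fun z => ?_)
    change aronBernerVal n (HomPoly.symForm (P + Q)) (fun _ => z) = _
    rw [h]
    exact aronBernerVal_add n (HomPoly.symForm P) (HomPoly.symForm Q) fun _ => z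
  map_smul' c P := by
    have h : HomPoly.symForm (c • P) = c • HomPoly.symForm P := by
      ext x
      simp only [HomPoly.symForm_apply, _root_.smul_apply, Submodule.coe_smul,
        Pi.smul_apply, smul_eq_mul, Finset.mul_sum]
      refine Finset.sum_congr rfl fun T _ => ?_
      simp only [zsmul_eq_mul]
      ring
    refine Subtype.ext (funext fun z => ?_)
    change aronBernerVal n (HomPoly.symForm (c • P)) (fun _ => z) = _
    rw [h]
    exact aronBernerVal_smul n c (HomPoly.symForm P) fun _ => z

end AronBerner

/-! ### Symmetric tensor products and s-tensor norms -/

section SymTensor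

variable (𝕜 : Type*) [RCLike 𝕜] (n : ℕ) (E : Type*) [NormedAddCommGroup E] [NormedSpace 𝕜 E]

/-- The `n`-fold symmetric tensor product of `E`: the subspace of the `n`-fold tensor product
spanned by the powers `x ⊗ ⋯ ⊗ x`. -/
def SymTensor : Submodule 𝕜 (⨂[𝕜] _ : Fin n, E) :=
  Submodule.span 𝕜 (Set.range fun x : E => PiTensorProduct.tprod 𝕜 fun _ : Fin n => x)

variable {𝕜 E}

variable (𝕜) in
/-- The power `x ⊗ ⋯ ⊗ x`. -/
def tensorPow (x : E) : SymTensor 𝕜 n E :=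
  ⟨PiTensorProduct.tprod 𝕜 fun _ : Fin n => x, Submodule.subset_span ⟨x, rfl⟩⟩

/-- The operator `T ⊗ ⋯ ⊗ T` between symmetric tensor products. -/
def symTensorMap {F : Type*} [NormedAddCommGroup F] [NormedSpace 𝕜 F] (T : E →L[𝕜] F) :
    SymTensor 𝕜 n E →ₗ[𝕜] SymTensor 𝕜 n F :=
  (PiTensorProduct.map fun _ : Fin n => (T : E →ₗ[𝕜] F)).restrict (by
    change SymTensor 𝕜 n E ≤ (SymTensor 𝕜 n F).comap _
    refine Submodule.span_le.mpr ?_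
    rintro _ ⟨x, rfl⟩
    simp only [Submodule.comap_coe, Set.mem_preimage, SetLike.mem_coe, PiTensorProduct.map_tprod]
    exact Submodule.subset_span ⟨T x, rfl⟩)

variable {n}

/-- The injective s-tensor norm: the supremum of the moduli of the values at `z` of the functionals
`φ ⊗ ⋯ ⊗ φ`, over the closed unit ball of `E'`. -/
def injectiveSNorm (z : SymTensor 𝕜 n E) : ℝ :=
  ⨆ φ : Metric.closedBall (0 : StrongDual 𝕜 E) 1,
    ‖PiTensorProduct.lift
      ((MultilinearMap.mkPiAlgebra 𝕜 (Fin n) 𝕜).compLinearMap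
        fun _ => ((φ : StrongDual 𝕜 E) : E →ₗ[𝕜] 𝕜)) (z : ⨂[𝕜] _ : Fin n, E)‖

/-- The projective s-tensor norm: the infimum of `∑ |λⱼ| ‖xⱼ‖ⁿ` over all finite representations
`z = ∑ λⱼ xⱼ ⊗ ⋯ ⊗ xⱼ`. -/
def projectiveSNorm (z : SymTensor 𝕜 n E) : ℝ :=
  sInf {r : ℝ | ∃ (k : ℕ) (c : Fin k → 𝕜) (x : Fin k → E),
    z = ∑ j, c j • tensorPow 𝕜 n (x j) ∧ r = ∑ j, ‖c j‖ * ‖x j‖ ^ n}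

theorem projectiveSNorm_tensorPow_le (x : E) : projectiveSNorm (tensorPow 𝕜 n x) ≤ ‖x‖ ^ n := by
  refine csInf_le ⟨0, ?_⟩ ⟨1, fun _ => 1, fun _ => x, by simp, by simp⟩
  rintro _ ⟨k, c, y, -, rfl⟩
  positivity

variable (𝕜 n E) in
/-- The symmetric product `x₁ ∨ ⋯ ∨ xₙ = (1 / n!) ∑ x_σ(1) ⊗ ⋯ ⊗ x_σ(n)`. -/
def symProd : MultilinearMap 𝕜 (fun _ : Fin n => E) (SymTensor 𝕜 n E) :=
  ((n.factorial : 𝕜)⁻¹ • ∑ σ : Equiv.Perm (Fin n),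
    (PiTensorProduct.tprod 𝕜 : MultilinearMap 𝕜 (fun _ : Fin n => E) _).domDomCongr σ).codRestrict
    (SymTensor 𝕜 n E) (by
      intro x
      simp only [_root_.smul_apply, _root_.sum_apply,
        MultilinearMap.domDomCongr_apply]
      rw [polarization_identity]
      refine Submodule.smul_mem _ _ (Submodule.sum_mem _ fun T _ => ?_)
      exact zsmul_mem (Submodule.subset_span (Set.mem_range_self (∑ i ∈ Tᶜ, x i))) _)

theorem symProd_apply (x : Fin n → E) : symProd 𝕜 n E x =
    (n.factorial : 𝕜)⁻¹ • ∑ T : Finset (Fin n),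
      (-1 : ℤ) ^ T.card • tensorPow 𝕜 n (∑ i ∈ Tᶜ, x i) := by
  apply Subtype.ext
  have h := polarization_identity
    (PiTensorProduct.tprod 𝕜 : MultilinearMap 𝕜 (fun _ : Fin n => E) _) x
  simp only [symProd, MultilinearMap.codRestrict_apply_coe, _root_.smul_apply,
    _root_.sum_apply, MultilinearMap.domDomCongr_apply, h, Submodule.coe_smul,
    AddSubmonoidClass.coe_finsetSum, AddSubgroupClass.coe_zsmul, tensorPow]

theorem symProd_diag (x : E) : symProd 𝕜 n E (fun _ => x) = tensorPow 𝕜 n x := by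
  apply Subtype.ext
  have h0 : (n.factorial : 𝕜) ≠ 0 := Nat.cast_ne_zero.mpr n.factorial_ne_zero
  simp only [symProd, MultilinearMap.codRestrict_apply_coe, _root_.smul_apply,
    _root_.sum_apply, MultilinearMap.domDomCongr_apply, tensorPow, Finset.sum_const,
    Finset.card_univ, Fintype.card_perm, Fintype.card_fin]
  rw [← Nat.cast_smul_eq_nsmul 𝕜, smul_smul, inv_mul_cancel₀ h0, one_smul]

end SymTensor

/-- An s-tensor norm of order `n` on the class of Banach spaces: a norm on the `n`-fold symmetric
tensor product of every Banach space, between the injective and the projective one, with the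
metric mapping property. -/
structure STensorNorm (𝕜 : Type u) [RCLike 𝕜] (n : ℕ) where
  norm : ∀ (E : Type u) [NormedAddCommGroup E] [NormedSpace 𝕜 E] [CompleteSpace E],
    Seminorm 𝕜 (SymTensor 𝕜 n E)
  eq_zero_of_norm_eq_zero : ∀ (E : Type u) [NormedAddCommGroup E] [NormedSpace 𝕜 E]
    [CompleteSpace E] (z : SymTensor 𝕜 n E), norm E z = 0 → z = 0
  injective_le : ∀ (E : Type u) [NormedAddCommGroup E] [NormedSpace 𝕜 E] [CompleteSpace E]
    (z : SymTensor 𝕜 n E), injectiveSNorm z ≤ norm E z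
  le_projective : ∀ (E : Type u) [NormedAddCommGroup E] [NormedSpace 𝕜 E] [CompleteSpace E]
    (z : SymTensor 𝕜 n E), norm E z ≤ projectiveSNorm z
  norm_map_le : ∀ (E F : Type u) [NormedAddCommGroup E] [NormedSpace 𝕜 E] [CompleteSpace E]
    [NormedAddCommGroup F] [NormedSpace 𝕜 F] [CompleteSpace F] (T : E →L[𝕜] F)
    (z : SymTensor 𝕜 n E), norm F (symTensorMap n T z) ≤ ‖T‖ ^ n * norm E z

namespace STensorNorm

variable {𝕜 : Type u} [RCLike 𝕜] {n : ℕ}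

/-- `α` is finitely generated: `α(z; ⊗E)` is the infimum of `α(w; ⊗M)` over all finite dimensional
subspaces `M` of `E` whose symmetric tensor product contains `z`, that is, `z` is the
image of some `w` under the map induced by the inclusion of `M`. -/
def FinitelyGenerated (α : STensorNorm 𝕜 n) : Prop :=
  ∀ (E : Type u) [NormedAddCommGroup E] [NormedSpace 𝕜 E] [CompleteSpace E]
    (z : SymTensor 𝕜 n E),
    IsGLB {r : ℝ | ∃ (M : Submodule 𝕜 E) (_ : FiniteDimensional 𝕜 M) (w : SymTensor 𝕜 n M),
      symTensorMap n M.subtypeL w = z ∧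
        r = haveI := FiniteDimensional.complete 𝕜 M; α.norm M w} (α.norm E z)

variable (α : STensorNorm 𝕜 n) (E : Type u) [NormedAddCommGroup E] [NormedSpace 𝕜 E]
  [CompleteSpace E]

/-- The symmetric tensor product of `E`, to be normed by `α`. -/
def Space (_ : STensorNorm 𝕜 n) (E : Type u) [NormedAddCommGroup E] [NormedSpace 𝕜 E]
    [CompleteSpace E] : Type u := SymTensor 𝕜 n E

instance : AddCommGroup (α.Space E) := inferInstanceAs (AddCommGroup (SymTensor 𝕜 n E))

instance : Module 𝕜 (α.Space E) := inferInstanceAs (Module 𝕜 (SymTensor 𝕜 n E))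

instance : NormedAddCommGroup (α.Space E) :=
  AddGroupNorm.toNormedAddCommGroup
    { toFun := fun z : SymTensor 𝕜 n E => α.norm E z
      map_zero' := map_zero (α.norm E)
      add_le' := map_add_le_add (α.norm E)
      neg' := map_neg_eq_map (α.norm E)
      eq_zero_of_map_eq_zero' := α.eq_zero_of_norm_eq_zero E }

instance : NormedSpace 𝕜 (α.Space E) where
  norm_smul_le c z := (map_smul_eq_mul (α.norm E) c z).le

/-- The completion of the symmetric tensor product of `E` normed by `α`. -/
abbrev Completion : Type u := UniformSpace.Completion (α.Space E)

variable {E}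

/-- The power `x ⊗ ⋯ ⊗ x` as an element of the completed symmetric tensor product. -/
def pow (x : E) : α.Completion E :=
  UniformSpace.Completion.coe' (α := α.Space E) (tensorPow 𝕜 n x)

variable {α}

/-- The `n`-linear form on `E` given by a functional on the completed symmetric tensor product. -/
def dualFormAux (φ : StrongDual 𝕜 (α.Completion E)) :
    MultilinearMap 𝕜 (fun _ : Fin n => E) 𝕜 :=
  (φ.comp (UniformSpace.Completion.toComplL : α.Space E →L[𝕜] α.Completion E)).toLinearMap
    |>.compMultilinearMap (symProd 𝕜 n E : MultilinearMap 𝕜 (fun _ : Fin n => E) (α.Space E))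

theorem norm_pow_le (x : E) : ‖α.pow x‖ ≤ ‖x‖ ^ n := by
  have h : ‖α.pow x‖ = α.norm E (tensorPow 𝕜 n x) :=
    UniformSpace.Completion.norm_coe (E := α.Space E) (tensorPow 𝕜 n x)
  rw [h]
  exact (α.le_projective E _).trans (projectiveSNorm_tensorPow_le x)

theorem dualFormAux_apply (φ : StrongDual 𝕜 (α.Completion E)) (x : Fin n → E) :
    dualFormAux φ x = (n.factorial : 𝕜)⁻¹ * ∑ T : Finset (Fin n),
      (-1 : ℤ) ^ T.card • φ (α.pow (∑ i ∈ Tᶜ, x i)) := by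
  let ℓ : SymTensor 𝕜 n E →ₗ[𝕜] 𝕜 :=
    (φ.comp (UniformSpace.Completion.toComplL : α.Space E →L[𝕜] α.Completion E)).toLinearMap
  have h : dualFormAux φ x = ℓ (symProd 𝕜 n E x) := rfl
  rw [h, symProd_apply, map_smul, map_sum, smul_eq_mul]
  congr 1
  refine Finset.sum_congr rfl fun T _ => ?_
  rw [map_zsmul]
  rfl

theorem dualFormAux_bound (φ : StrongDual 𝕜 (α.Completion E)) :
    ∃ C : ℝ, ∀ x : Fin n → E, ‖dualFormAux φ x‖ ≤ C * ∏ i, ‖x i‖ := by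
  refine ⟨‖(n.factorial : 𝕜)⁻¹‖ * ∑ _T : Finset (Fin n), ‖φ‖ * (n : ℝ) ^ n, fun x => ?_⟩
  by_cases hx : ∃ i, x i = 0
  · obtain ⟨i, hi⟩ := hx
    rw [(dualFormAux φ).map_coord_zero i hi, norm_zero]
    positivity
  · push Not at hx
    have key : ∀ y : Fin n → E, (∀ i, ‖y i‖ ≤ 1) →
        ‖dualFormAux φ y‖ ≤ ‖(n.factorial : 𝕜)⁻¹‖ * ∑ _T : Finset (Fin n), ‖φ‖ * (n : ℝ) ^ n := by
      intro y hy
      rw [dualFormAux_apply, norm_mul]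
      gcongr
      refine (norm_sum_le _ _).trans (Finset.sum_le_sum fun T _ => ?_)
      have h1 : ‖(-1 : ℤ) ^ T.card • φ (α.pow (∑ i ∈ Tᶜ, y i))‖ =
          ‖φ (α.pow (∑ i ∈ Tᶜ, y i))‖ := by
        rcases neg_one_pow_eq_or ℤ T.card with h | h <;> simp [h]
      have h2 : ‖∑ i ∈ Tᶜ, y i‖ ≤ n := by
        refine (norm_sum_le _ _).trans ((Finset.sum_le_sum fun i _ => hy i).trans ?_)
        simpa using Finset.card_le_univ (Tᶜ)
      rw [h1]
      refine (φ.le_opNorm _).trans ?_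
      gcongr
      exact (norm_pow_le _).trans (by gcongr)
    have hs : x = fun i => ((‖x i‖ : ℝ) : 𝕜) • (((‖x i‖ : ℝ) : 𝕜)⁻¹ • x i) := by
      funext i
      have : ((‖x i‖ : ℝ) : 𝕜) ≠ 0 := by simpa using hx i
      rw [smul_smul, mul_inv_cancel₀ this, one_smul]
    conv_lhs => rw [hs]
    rw [MultilinearMap.map_smul_univ, norm_smul, norm_prod, mul_comm]
    simp only [RCLike.norm_ofReal, abs_norm]
    gcongr
    refine key _ fun i => ?_
    have : ‖x i‖ ≠ 0 := by simpa using hx i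
    simp [norm_smul, this]

/-- The continuous `n`-homogeneous polynomial `x ↦ φ (x ⊗ ⋯ ⊗ x)` that is identified with the
functional `φ` on the completed symmetric tensor product. -/
def toPoly (φ : StrongDual 𝕜 (α.Completion E)) : HomPoly 𝕜 n E :=
  ⟨fun x => φ (α.pow x), (dualFormAux φ).mkContinuous _ (dualFormAux_bound φ).choose_spec, by
    funext x
    change φ.comp (UniformSpace.Completion.toComplL : α.Space E →L[𝕜] α.Completion E)
      (symProd 𝕜 n E fun _ => x) = _
    rw [symProd_diag]
    rfl⟩

end STensorNorm

/-! ### Polynomial ideals -/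

/-- A Banach ideal of continuous scalar valued `n`-homogeneous polynomials. -/
structure PolyIdeal (𝕜 : Type u) [RCLike 𝕜] (n : ℕ) where
  /-- The component `𝒬(E)`. -/
  space : ∀ (E : Type u) [NormedAddCommGroup E] [NormedSpace 𝕜 E] [CompleteSpace E],
    Submodule 𝕜 (HomPoly 𝕜 n E)
  /-- The ideal norm on `𝒬(E)`. -/
  norm : ∀ (E : Type u) [NormedAddCommGroup E] [NormedSpace 𝕜 E] [CompleteSpace E],
    Seminorm 𝕜 (space E)
  eq_zero_of_norm_eq_zero : ∀ (E : Type u) [NormedAddCommGroup E] [NormedSpace 𝕜 E]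
    [CompleteSpace E] (P : space E), norm E P = 0 → P = 0
  /-- `𝒬(E)` is complete: Cauchy sequences converge. -/
  complete : ∀ (E : Type u) [NormedAddCommGroup E] [NormedSpace 𝕜 E] [CompleteSpace E]
    (p : ℕ → space E),
    (∀ ε > 0, ∃ N, ∀ k ≥ N, ∀ l ≥ N, norm E (p k - p l) < ε) →
      ∃ P : space E, Tendsto (fun k => norm E (p k - P)) atTop (𝓝 0)
  comp_mem : ∀ (E F : Type u) [NormedAddCommGroup E] [NormedSpace 𝕜 E] [CompleteSpace E]
    [NormedAddCommGroup F] [NormedSpace 𝕜 F] [CompleteSpace F] (T : F →L[𝕜] E)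
    (P : HomPoly 𝕜 n E), P ∈ space E → HomPoly.comp P T ∈ space F
  norm_comp_le : ∀ (E F : Type u) [NormedAddCommGroup E] [NormedSpace 𝕜 E] [CompleteSpace E]
    [NormedAddCommGroup F] [NormedSpace 𝕜 F] [CompleteSpace F] (T : F →L[𝕜] E)
    (P : HomPoly 𝕜 n E) (hP : P ∈ space E),
    norm F ⟨HomPoly.comp P T, comp_mem E F T P hP⟩ ≤ norm E ⟨P, hP⟩ * ‖T‖ ^ n
  pow_mem : HomPoly.pow 𝕜 n ∈ space 𝕜
  norm_pow : norm 𝕜 ⟨HomPoly.pow 𝕜 n, pow_mem⟩ = 1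

namespace PolyIdeal

variable {𝕜 : Type u} [RCLike 𝕜] {n : ℕ} (𝒬 : PolyIdeal 𝕜 n)

open Classical in
/-- The ideal norm as a function on `𝒫ⁿ(E)`, with value `∞` outside `𝒬(E)`. -/
def extNorm {E : Type u} [NormedAddCommGroup E] [NormedSpace 𝕜 E] [CompleteSpace E]
    (P : HomPoly 𝕜 n E) : ℝ≥0∞ :=
  if h : P ∈ 𝒬.space E then ENNReal.ofReal (𝒬.norm E ⟨P, h⟩) else ∞

/-- The norm of the maximal kernel: the supremum of the ideal norms of the restrictions of `P` to
the finite dimensional subspaces. -/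
def maxNorm {E : Type u} [NormedAddCommGroup E] [NormedSpace 𝕜 E] [CompleteSpace E]
    (P : HomPoly 𝕜 n E) : ℝ≥0∞ :=
  ⨆ (M : Submodule 𝕜 E) (_ : FiniteDimensional 𝕜 M),
    haveI := FiniteDimensional.complete 𝕜 M; 𝒬.extNorm (HomPoly.comp P M.subtypeL)

/-- `𝒬` is maximal: it coincides isometrically with its maximal kernel, the ideal of all `P` with
`maxNorm P < ∞`, normed by `maxNorm`. -/
def IsMaximal : Prop :=
  ∀ (E : Type u) [NormedAddCommGroup E] [NormedSpace 𝕜 E] [CompleteSpace E]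
    (P : HomPoly 𝕜 n E), 𝒬.extNorm P = 𝒬.maxNorm P

end PolyIdeal

end

/-! The crux is a finite-dimensional approximation. If `M` is finite dimensional and `J : M → E''`
is a contraction, then `AB(P) ∘ J` is a pointwise limit of polynomials `P ∘ T` with contractions `T
: M → E` (`exists_filter_tendsto_aronBerner`). The mapping property bounds the norm of each `P ∘ T`
by that of `P`, and in finite dimensions this bound survives pointwise limits. Finite generation of
`α`, or maximality of `𝒬`, reduces the norm on `E''` to finite-dimensional subspaces, which gives
`‖AB(P)‖ ≤ ‖P‖`. The reverse inequality holds because `AB(P)` restricts to `P` along the canonical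
embedding (`aronBerner_inclusion`), itself a contraction.

The approximation has two ingredients. A Helly-type separation argument on a finite net of the unit
ball of `M` produces contractions `R : M → E` tending to `J` pointwise weak-star
(`exists_contraction_approx`). Since `P` is in general not weak-star continuous on bounded sets, `P
∘ R` need not converge to `AB(P) ∘ J`. Operators `R₀, R₁, …` are therefore chosen one after the
other, so that the symmetric form evaluated at `R_{i₁} z, …, R_{iₙ} z` with distinct indices has the
Aron–Berner value as iterated limit. The average of `R₀, …, R_{N-1}` is still a contraction, and
expanding the form on it yields mostly tuples of distinct indices; the others have proportion
tending to `0` as `N → ∞` (`tendsto_average_aronBernerVal`). -/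

noncomputable section


/-! ### Approximation of operators into the bidual by operators into the space -/

section LocalReflexivity

variable {𝕜 : Type*} [RCLike 𝕜]

/-- A form of Helly's lemma: if a linear functional `ξ` on `X'` satisfies `‖ξ (h ∘ S)‖ ≤ ‖h‖` for
all `h ∈ Y'`, then its values at finitely many functionals are almost attained at some `x ∈ X`
with `‖S x‖ < ρ`, for any given `ρ > 1`. -/
theorem exists_norm_lt_and_approx {X Y : Type*} [NormedAddCommGroup X] [NormedSpace 𝕜 X]
    [NormedAddCommGroup Y] [NormedSpace 𝕜 Y] (S : X →L[𝕜] Y) (ξ : StrongDual 𝕜 X →ₗ[𝕜] 𝕜)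
    (hξ : ∀ h : StrongDual 𝕜 Y, ‖ξ (h.comp S)‖ ≤ ‖h‖) {ι : Type*} [Fintype ι]
    (f : ι → StrongDual 𝕜 X) {ρ ε : ℝ} (hρ : 1 < ρ) (hε : 0 < ε) :
    ∃ x, ‖S x‖ < ρ ∧ ∀ i, ‖f i x - ξ (f i)‖ < ε := by
  classical
  let _ : NormedSpace ℝ Y := NormedSpace.restrictScalars ℝ 𝕜 Y
  have : IsScalarTower ℝ 𝕜 Y := ⟨fun r c y => by
    rw [RCLike.real_smul_eq_coe_smul (K := 𝕜) r c, smul_eq_mul, mul_smul]; rfl⟩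
  let t : ι → 𝕜 := fun i => ξ (f i)
  let Φ : X →L[𝕜] Y × (ι → 𝕜) := S.prod (ContinuousLinearMap.pi f)
  let C : Set (Y × (ι → 𝕜)) := Metric.ball 0 ρ ×ˢ Metric.ball t ε
  -- If no such `x` exists, the open convex set `C` misses the range of `Φ = (S, f)`, and
  -- Hahn–Banach separates them.
  by_contra! hcon
  have hdisj : Disjoint C (LinearMap.range (Φ : X →ₗ[𝕜] Y × (ι → 𝕜)) : Set (Y × (ι → 𝕜))) := by
    rw [Set.disjoint_left]
    rintro _ hC ⟨x, rfl⟩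
    obtain ⟨h1, h2⟩ := hC
    obtain ⟨i, hi⟩ := hcon x (by simpa [Φ] using h1)
    have h3 := (dist_pi_lt_iff hε).mp (Metric.mem_ball.mp h2) i
    rw [dist_eq_norm] at h3
    exact absurd h3 (not_lt.mpr hi)
  obtain ⟨F, u, hF1, hF2⟩ := RCLike.geometric_hahn_banach_open (𝕜 := 𝕜)
    ((convex_ball (0 : Y) ρ).prod (convex_ball t ε)) (Metric.isOpen_ball.prod Metric.isOpen_ball)
    ((LinearMap.range (Φ : X →ₗ[𝕜] Y × (ι → 𝕜))).restrictScalars ℝ).convex hdisj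
  have hu : u ≤ 0 := by simpa using hF2 0 (Submodule.zero_mem _)
  have hFΦ : ∀ x, F (Φ x) = 0 := by
    intro x
    by_contra hne
    -- A functional bounded below in real part on a subspace vanishes there: otherwise rescaling `x`
    -- would give it the value `u - 1`.
    have h1 := hF2 (Φ ((((u - 1 : ℝ) : 𝕜) * (F (Φ x))⁻¹) • x)) ⟨_, rfl⟩
    rw [map_smul, map_smul, smul_eq_mul, mul_assoc, inv_mul_cancel₀ hne, mul_one,
      RCLike.ofReal_re] at h1
    linarith
  let h : StrongDual 𝕜 Y := F.comp (ContinuousLinearMap.inl 𝕜 Y (ι → 𝕜))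
  let c : ι → 𝕜 := fun i => F (0, Pi.single i 1)
  have hF : ∀ y s, F (y, s) = h y + ∑ i, s i * c i := by
    intro y s
    have h1 : (y, s) = (y, 0) + ∑ i, s i • ((0 : Y), (Pi.single i 1 : ι → 𝕜)) := by
      ext j
      · simp [Prod.fst_sum]
      · simp [Prod.snd_sum, Finset.sum_apply, Pi.single_apply]
    rw [h1, map_add, map_sum]
    simp only [map_smul, smul_eq_mul]
    rfl
  have hcomp : h.comp S = -∑ i, c i • f i := by
    ext x
    have h1 := hFΦ x
    change F (S x, fun i => f i x) = 0 at h1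
    rw [hF] at h1
    simp only [ContinuousLinearMap.comp_apply, neg_apply, sum_apply, smul_apply, smul_eq_mul]
    rw [eq_neg_iff_add_eq_zero, ← h1]
    simp only [mul_comm]
  have hval : ξ (h.comp S) = -∑ i, t i * c i := by
    rw [hcomp, map_neg, map_sum]
    simp [t, mul_comm]
  -- Since `F` vanishes on the range, `h ∘ S = -∑ cᵢ fᵢ`, so `F (v, t) = h v - ξ (h ∘ S)`. The real
  -- part is negative on `C`, which bounds `re (h v)` by `‖h‖` on the whole ball of radius `ρ > 1`:
  -- a contradiction.
  have hlt : ∀ v : Y, ‖v‖ < ρ → RCLike.re (h v) < ‖h‖ := by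
    intro v hv
    have h1 := hF1 (v, t) ⟨by simpa using hv, Metric.mem_ball_self hε⟩
    have h2 : ∑ i, t i * c i = -ξ (h.comp S) := by rw [hval, neg_neg]
    rw [hF, h2, map_add, map_neg] at h1
    have h3 := (RCLike.re_le_norm (ξ (h.comp S))).trans (hξ h)
    linarith
  have hpos : 0 < ‖h‖ := by simpa using hlt 0 (by simpa using zero_lt_one.trans hρ)
  obtain ⟨v, hv1, hv2⟩ := h.exists_lt_apply_of_lt_opNorm (div_lt_self hpos hρ)
  obtain ⟨d, hd1, hd2⟩ := RCLike.exists_norm_eq_mul_self (h v)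
  have hρ0 : 0 < ρ := zero_lt_one.trans hρ
  -- The unimodular `d` makes the value real and nonnegative; scaling by `ρ` pushes it above `‖h‖`.
  have h1 := hlt (((ρ : ℝ) : 𝕜) • d • v) (by
    rw [norm_smul, norm_smul, hd1, one_mul, RCLike.norm_of_nonneg hρ0.le]
    nlinarith)
  rw [h.map_smul, h.map_smul, smul_eq_mul, smul_eq_mul, ← hd2, ← RCLike.ofReal_mul,
    RCLike.ofReal_re] at h1
  rw [div_lt_iff₀ hρ0] at hv2
  linarith

/-- On a finite product with the sup norm, the norms of the components of a functional add up to
at most its norm. -/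
theorem sum_norm_comp_single_le {E ι : Type*} [NormedAddCommGroup E] [NormedSpace 𝕜 E]
    [Fintype ι] [DecidableEq ι] (h : StrongDual 𝕜 (ι → E)) :
    ∑ i, ‖h.comp (ContinuousLinearMap.single 𝕜 (fun _ : ι => E) i)‖ ≤ ‖h‖ := by
  have key : ∀ r : ι → ℝ, (∀ i, r i < ‖h.comp (ContinuousLinearMap.single 𝕜 (fun _ : ι => E) i)‖) →
      ∑ i, r i ≤ ‖h‖ := by
    intro r hr
    -- Almost norming vectors of the components, rotated by unimodular `d i`, form one vector of sup
    -- norm at most `1` on which the contributions add without cancellation.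
    choose v hv1 hv2 using fun i =>
      (h.comp (ContinuousLinearMap.single 𝕜 (fun _ : ι => E) i)).exists_lt_apply_of_lt_opNorm (hr i)
    choose d hd1 hd2 using fun i => RCLike.exists_norm_eq_mul_self
      (h.comp (ContinuousLinearMap.single 𝕜 (fun _ : ι => E) i) (v i))
    have hw : ‖fun i => d i • v i‖ ≤ 1 := by
      refine (pi_norm_le_iff_of_nonneg zero_le_one).mpr fun i => ?_
      rw [norm_smul, hd1, one_mul]
      exact (hv1 i).le
    have hs : h (fun i => d i • v i) = ∑ i,
        ((‖h.comp (ContinuousLinearMap.single 𝕜 (fun _ : ι => E) i) (v i)‖ : ℝ) : 𝕜) := by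
      have h1 : (fun i => d i • v i) = ∑ i, d i • (Pi.single i (v i) : ι → E) := by
        funext j
        simp [Finset.sum_apply, Pi.single_apply]
      rw [h1, map_sum]
      refine Finset.sum_congr rfl fun i _ => ?_
      rw [hd2, map_smul]
      rfl
    have h2 := h.le_of_opNorm_le le_rfl (fun i => d i • v i)
    rw [hs, ← RCLike.ofReal_sum, RCLike.norm_of_nonneg (by positivity)] at h2
    calc ∑ i, r i ≤ _ := Finset.sum_le_sum fun i _ => (hv2 i).le
      _ ≤ _ := h2
      _ ≤ ‖h‖ * 1 := by gcongr
      _ = ‖h‖ := mul_one _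
  refine le_of_forall_pos_le_add fun δ hδ => ?_
  -- The `+ 1` in the denominator covers an empty index type.
  have h1 := key (fun i => ‖h.comp (ContinuousLinearMap.single 𝕜 (fun _ : ι => E) i)‖ -
    δ / (Fintype.card ι + 1)) fun i => sub_lt_self _ (by positivity)
  rw [Finset.sum_sub_distrib, Finset.sum_const, Finset.card_univ, nsmul_eq_mul] at h1
  have h2 : (Fintype.card ι : ℝ) * (δ / (Fintype.card ι + 1)) ≤ δ := by
    rw [mul_div_assoc', div_le_iff₀ (by positivity)]
    nlinarith
  linarith

/-- An operator bounded by `ρ` on a `δ`-net of the unit ball, `δ < 1`, satisfies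
`(1 - δ) ‖R‖ ≤ ρ`. -/
theorem one_sub_mul_opNorm_le_of_net {M E : Type*} [NormedAddCommGroup M] [NormedSpace 𝕜 M]
    [NormedAddCommGroup E] [NormedSpace 𝕜 E] (R : M →L[𝕜] E) {s : Set M} {ρ δ : ℝ} (hρ : 0 ≤ ρ)
    (hs : Metric.closedBall (0 : M) 1 ⊆ ⋃ y ∈ s, Metric.ball y δ) (hR : ∀ y ∈ s, ‖R y‖ ≤ ρ)
    (hδ : 0 ≤ δ) : (1 - δ) * ‖R‖ ≤ ρ := by
  have h1 : ‖R‖ ≤ ρ + ‖R‖ * δ := by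
    refine R.opNorm_le_of_unit_norm (by positivity) fun x hx => ?_
    obtain ⟨y, hy, hxy⟩ := Set.mem_iUnion₂.mp (hs (by simp [hx] : x ∈ Metric.closedBall (0 : M) 1))
    rw [Metric.mem_ball, dist_eq_norm] at hxy
    calc ‖R x‖ = ‖R y + R (x - y)‖ := by rw [← map_add]; simp
      _ ≤ ‖R y‖ + ‖R (x - y)‖ := norm_add_le _ _
      _ ≤ ρ + ‖R‖ * δ := by
        gcongr
        · exact hR y hy
        · exact (R.le_opNorm _).trans (by gcongr)
  linarith

variable {E M : Type*} [NormedAddCommGroup E] [NormedSpace 𝕜 E] [NormedAddCommGroup M]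
  [NormedSpace 𝕜 M] [FiniteDimensional 𝕜 M]

/-- For `J : M → E''` with `M` finite dimensional, the functional on `(M → E)'` given by `J`. -/
def operatorBidual (J : M →ₗ[𝕜] Bidual 𝕜 E) : StrongDual 𝕜 (M →L[𝕜] E) →ₗ[𝕜] 𝕜 where
  toFun u := ∑ i, J (Module.finBasis 𝕜 M i) (u.comp (ContinuousLinearMap.smulRightL 𝕜 M E
    (LinearMap.toContinuousLinearMap ((Module.finBasis 𝕜 M).coord i))))
  map_add' u v := by
    simp only [ContinuousLinearMap.add_comp, map_add, Finset.sum_add_distrib]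
  map_smul' c u := by
    simp only [ContinuousLinearMap.smul_comp, map_smul, Finset.smul_sum, RingHom.id_apply]

/-- Expanding `z` in the chosen basis shows that on evaluation functionals the basis disappears.
Hence approximating `operatorBidual J` at such functionals, as Helly's lemma does, means
approximating `J` pointwise weak-star. -/
theorem operatorBidual_eval (J : M →ₗ[𝕜] Bidual 𝕜 E) (f : StrongDual 𝕜 E) (z : M) :
    operatorBidual J (f.comp (ContinuousLinearMap.apply 𝕜 E z)) = J z f := by
  simp only [operatorBidual, LinearMap.coe_mk, AddHom.coe_mk]
  conv_rhs => rw [← (Module.finBasis 𝕜 M).sum_repr z, map_sum, sum_apply]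
  refine Finset.sum_congr rfl fun i _ => ?_
  rw [map_smul, smul_apply, ← map_smul]
  congr 1
  ext x
  simp

/-- A contraction from a finite dimensional space to `E''` is approximated by contractions
to `E`, weak-star at finitely many points. -/
theorem exists_contraction_approx (J : M →ₗ[𝕜] Bidual 𝕜 E) (hJ : ∀ z, ‖J z‖ ≤ ‖z‖)
    (s : Finset (M × StrongDual 𝕜 E)) {ε : ℝ} (hε : 0 < ε) :
    ∃ R : M →L[𝕜] E, ‖R‖ ≤ 1 ∧ ∀ p ∈ s, ‖p.2 (R p.1) - J p.1 p.2‖ < ε := by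
  classical
  have : ProperSpace M := FiniteDimensional.proper 𝕜 M
  obtain ⟨B, hB0, hB⟩ : ∃ B : ℝ, 0 < B ∧ ∀ p ∈ s, ‖J p.1 p.2‖ ≤ B := by
    refine ⟨∑ p ∈ s, ‖J p.1 p.2‖ + 1, by positivity, fun p hp => ?_⟩
    have := Finset.single_le_sum (f := fun p : M × StrongDual 𝕜 E => ‖J p.1 p.2‖)
      (fun _ _ => norm_nonneg _) hp
    linarith
  obtain ⟨δ, hδ0, hδ1, hδB⟩ : ∃ δ : ℝ, 0 < δ ∧ δ < 1 ∧ 2 * δ * B < ε / 2 := by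
    refine ⟨min (1 / 2) (ε / (8 * B)), by positivity, by
      exact (min_le_left _ _).trans_lt (by norm_num), ?_⟩
    have h1 : min (1 / 2) (ε / (8 * B)) * B ≤ ε / 8 := by
      calc _ ≤ ε / (8 * B) * B := by gcongr; exact min_le_right _ _
        _ = ε / 8 := by field_simp
    linarith
  obtain ⟨t, ht1, htf, ht2⟩ := (isCompact_closedBall (0 : M) 1).finite_cover_balls hδ0
  have : Fintype t := htf.fintype
  let S : (M →L[𝕜] E) →L[𝕜] (t → E) :=
    ContinuousLinearMap.pi fun y => ContinuousLinearMap.apply 𝕜 E (y : M)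
  -- A functional on `t → E` splits into components `h_y`, and the value is `∑ J(y)(h_y)`. As `‖J y‖
  -- ≤ ‖y‖ ≤ 1` on the net, it is at most `∑ ‖h_y‖ ≤ ‖h‖`.
  have hξ : ∀ h : StrongDual 𝕜 (t → E), ‖operatorBidual J (h.comp S)‖ ≤ ‖h‖ := by
    intro h
    have h1 : h.comp S = ∑ y, (h.comp (ContinuousLinearMap.single 𝕜 (fun _ : t => E) y)).comp
        (ContinuousLinearMap.apply 𝕜 E (y : M)) := by
      ext R
      have h2 : S R = ∑ y : t, (Pi.single y (R y) : t → E) := by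
        rw [Finset.univ_sum_single]; rfl
      rw [ContinuousLinearMap.comp_apply, h2, map_sum, sum_apply]
      rfl
    rw [h1, map_sum]
    refine (norm_sum_le _ _).trans (le_trans (Finset.sum_le_sum fun y _ => ?_)
      (sum_norm_comp_single_le h))
    rw [operatorBidual_eval]
    refine ((J y).le_opNorm _).trans (mul_le_of_le_one_left (norm_nonneg _) ?_)
    have hy : ‖(y : M)‖ ≤ 1 := by simpa using ht1 y.2
    exact (hJ y).trans hy
  obtain ⟨R, hR1, hR2⟩ := exists_norm_lt_and_approx S (operatorBidual J) hξ
    (fun p : s => p.1.2.comp (ContinuousLinearMap.apply 𝕜 E p.1.1))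
    (ρ := 1 + δ) (by linarith) (half_pos hε)
  have hnorm : (1 - δ) * ‖R‖ ≤ 1 + δ := by
    refine one_sub_mul_opNorm_le_of_net R (by positivity) ht2 (fun y hy => ?_) hδ0.le
    exact (norm_le_pi_norm (S R) ⟨y, hy⟩).trans hR1.le
  -- The operator `R` is only bounded by `(1 + δ) / (1 - δ)`. Shrinking it by `κ` makes it a
  -- contraction, at the cost of an error of at most `2δB < ε / 2` in the values.
  let κ : ℝ := (1 - δ) / (1 + δ)
  have hκ0 : 0 ≤ κ := div_nonneg (by linarith) (by linarith)
  have hκ1 : κ ≤ 1 := (div_le_one (by linarith)).mpr (by linarith)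
  have hκ2 : 1 - κ ≤ 2 * δ := by
    have : 1 - κ = 2 * δ / (1 + δ) := by simp only [κ]; field_simp; ring
    rw [this]
    exact div_le_self (by positivity) (by linarith)
  refine ⟨(κ : 𝕜) • R, ?_, fun p hp => ?_⟩
  · rw [norm_smul, RCLike.norm_of_nonneg hκ0, div_mul_eq_mul_div]
    exact (div_le_one (by linarith)).mpr hnorm
  · have h1 := hR2 ⟨p, hp⟩
    rw [operatorBidual_eval] at h1
    simp only [ContinuousLinearMap.comp_apply, ContinuousLinearMap.apply_apply] at h1
    have h2 : p.2 (((κ : 𝕜) • R) p.1) - J p.1 p.2 =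
        (κ : 𝕜) * (p.2 (R p.1) - J p.1 p.2) - ((1 - κ : ℝ) : 𝕜) * J p.1 p.2 := by
      rw [smul_apply, map_smul, smul_eq_mul, RCLike.ofReal_sub, RCLike.ofReal_one]
      ring
    rw [h2]
    refine (norm_sub_le _ _).trans_lt ?_
    rw [norm_mul, norm_mul, RCLike.norm_of_nonneg hκ0, RCLike.norm_of_nonneg (by linarith)]
    have h3 : κ * ‖p.2 (R p.1) - J p.1 p.2‖ ≤ ‖p.2 (R p.1) - J p.1 p.2‖ :=
      mul_le_of_le_one_left (norm_nonneg _) hκ1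
    have h4 : (1 - κ) * ‖J p.1 p.2‖ ≤ 2 * δ * B := by
      gcongr
      exact hB p hp
    linarith

/-- A contraction from a finite dimensional space to `E''` is the pointwise weak-star limit of
contractions to `E`. -/
theorem exists_filter_contractions (J : M →ₗ[𝕜] Bidual 𝕜 E) (hJ : ∀ z, ‖J z‖ ≤ ‖z‖) :
    ∃ l : Filter (M →L[𝕜] E), l.NeBot ∧ (∀ᶠ R in l, ‖R‖ ≤ 1) ∧
      ∀ (z : M) (f : StrongDual 𝕜 E), Tendsto (fun R : M →L[𝕜] E => f (R z)) l (𝓝 (J z f)) := by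
  classical
  -- The net is indexed by finite sets of test pairs together with a tolerance `1 / (k + 1)`.
  choose R hR1 hR2 using fun i : Finset (M × StrongDual 𝕜 E) × ℕ =>
    exists_contraction_approx J hJ i.1 (Nat.one_div_pos_of_nat (α := ℝ) (n := i.2))
  refine ⟨map R atTop, inferInstance, eventually_map.mpr (Eventually.of_forall hR1), fun z f => ?_⟩
  rw [tendsto_map'_iff, Metric.tendsto_atTop]
  intro ε hε
  obtain ⟨k, hk⟩ := exists_nat_one_div_lt hε
  refine ⟨({(z, f)}, k), fun i hi => ?_⟩
  rw [dist_eq_norm]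
  refine (hR2 i (z, f) (hi.1 (by simp))).trans_le (le_trans ?_ hk.le)
  exact Nat.one_div_le_one_div hi.2

end LocalReflexivity


/-! ### The Aron–Berner extension as a limit along averages of operators -/

section IteratedLimits

theorem Filter.NeBot.bind {X Y : Type*} {f : Filter X} {m : X → Filter Y} (hf : f.NeBot)
    (hm : ∀ x, (m x).NeBot) : (f.bind m).NeBot := by
  rw [neBot_iff, Ne, ← eventually_false_iff_eq_bot, eventually_bind]
  simp only [eventually_false_iff_eq_bot, (hm _).ne]
  exact hf.ne

/-- A limit along `f.bind m` from iterated limits. -/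
theorem Filter.Tendsto.bind_nhds {X Y Z : Type*} [PseudoMetricSpace Z] {f : Filter X}
    {m : X → Filter Y} {F : Y → Z} {g : X → Z} {c : Z} (hg : Tendsto g f (𝓝 c))
    (hF : ∀ x, Tendsto F (m x) (𝓝 (g x))) : Tendsto F (f.bind m) (𝓝 c) := by
  rw [Metric.tendsto_nhds] at hg ⊢
  intro ε hε
  rw [eventually_bind]
  filter_upwards [hg (ε / 2) (half_pos hε)] with x hx
  filter_upwards [Metric.tendsto_nhds.mp (hF x) (ε / 2) (half_pos hε)] with y hy
  calc dist (F y) c ≤ dist (F y) (g x) + dist (g x) c := dist_triangle _ _ _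
    _ < ε := by linarith

/-- The iterated filter for sequences whose first `N` terms are chosen one after the other
along `l`; the other terms are `a`. -/
def iterFilter {X : Type*} (l : Filter X) (a : X) : ℕ → Filter (ℕ → X)
  | 0 => pure fun _ => a
  | N + 1 => (iterFilter l a N).bind fun R => l.map (Function.update R N)

theorem iterFilter_neBot {X : Type*} {l : Filter X} (hl : l.NeBot) (a : X) :
    ∀ N, (iterFilter l a N).NeBot
  | 0 => pure_neBot
  | N + 1 => (iterFilter_neBot hl a N).bind fun _ => hl.map _

theorem eventually_iterFilter {X : Type*} {l : Filter X} {p : X → Prop} (hl : ∀ᶠ x in l, p x)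
    (a : X) : ∀ N, ∀ᶠ R in iterFilter l a N, ∀ i < N, p (R i)
  | 0 => by simp [iterFilter]
  | N + 1 => by
      simp only [iterFilter, eventually_bind, eventually_map]
      filter_upwards [eventually_iterFilter hl a N] with R hR
      filter_upwards [hl] with x hx i hi
      rcases Nat.lt_succ_iff_lt_or_eq.mp hi with h | rfl
      · rw [Function.update_of_ne h.ne]
        exact hR i h
      · rwa [Function.update_self]

variable {𝕜 : Type*} [RCLike 𝕜] {E M : Type*} [NormedAddCommGroup E] [NormedSpace 𝕜 E]
  [NormedAddCommGroup M] [NormedSpace 𝕜 M]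

/-- In `iterFilter` the term chosen last gives the innermost limit, and the Aron–Berner extension
treats the last variable first; increasing indices match the two orders. In the induction on `N`,
either the newest operator does not occur, or it occurs in the last slot only, where its limit
replaces that variable by `z'`. -/
theorem tendsto_iterFilter_aronBernerVal {l : Filter (M →L[𝕜] E)} {z : M} {z' : Bidual 𝕜 E}
    (hl : ∀ f : StrongDual 𝕜 E, Tendsto (fun R : M →L[𝕜] E => f (R z)) l (𝓝 (z' f))) :
    ∀ (N n : ℕ) (A : E [×n]→L[𝕜] 𝕜) (i : Fin n → ℕ), StrictMono i → (∀ j, i j < N) →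
      Tendsto (fun R : ℕ → M →L[𝕜] E => A fun j => R (i j) z) (iterFilter l 0 N)
        (𝓝 (aronBernerVal n A fun _ => z'))
  | N, 0, A, i, _, _ => by
      have h : ∀ R : ℕ → M →L[𝕜] E, (A fun j => R (i j) z) = aronBernerVal 0 A fun _ => z' :=
        fun R => congrArg A (Subsingleton.elim _ _)
      simp only [h]
      exact tendsto_const_nhds
  | 0, n + 1, _, i, _, hN => absurd (hN 0) (Nat.not_lt_zero _)
  | N + 1, n + 1, A, i, hi, hN => by
      have hcast : ∀ j : Fin n, i j.castSucc < i (Fin.last n) :=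
        fun j => hi (Fin.castSucc_lt_last j)
      rcases Nat.lt_succ_iff_lt_or_eq.mp (hN (Fin.last n)) with h | h
      · have hlt : ∀ j, i j < N := fun j => (hi.monotone (Fin.le_last j)).trans_lt h
        refine (tendsto_iterFilter_aronBernerVal hl N (n + 1) A i hi hlt).bind_nhds fun R => ?_
        rw [tendsto_map'_iff]
        refine tendsto_const_nhds.congr fun r => ?_
        simp only [Function.comp_apply]
        congr 1
        funext j
        rw [Function.update_of_ne (hlt j).ne]
      · let A' : E [×n]→L[𝕜] 𝕜 := z'.compContinuousMultilinearMap A.curryRight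
        refine (tendsto_iterFilter_aronBernerVal hl N n A' (fun j => i j.castSucc)
          (fun a b hab => hi (Fin.castSucc_lt_castSucc_iff.mpr hab))
          fun j => h ▸ hcast j).bind_nhds fun R => ?_
        rw [tendsto_map'_iff]
        refine (hl (A.curryRight fun j => R (i j.castSucc) z)).congr fun r => ?_
        rw [ContinuousMultilinearMap.curryRight_apply]
        simp only [Function.comp_apply]
        congr 1
        funext j
        induction j using Fin.lastCases with
        | last => rw [Fin.snoc_last, h, Function.update_self]
        | cast j => rw [Fin.snoc_castSucc, Function.update_of_ne (h ▸ hcast j).ne]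

/-- For symmetric forms the order of the distinct indices does not matter. -/
theorem tendsto_iterFilter_of_injective {l : Filter (M →L[𝕜] E)} {z : M} {z' : Bidual 𝕜 E}
    (hl : ∀ f : StrongDual 𝕜 E, Tendsto (fun R : M →L[𝕜] E => f (R z)) l (𝓝 (z' f)))
    {N n : ℕ} {A : E [×n]→L[𝕜] 𝕜}
    (hA : ∀ (τ : Equiv.Perm (Fin n)) (x : Fin n → E), A (fun j => x (τ j)) = A x)
    {i : Fin n → Fin N} (hi : Function.Injective i) :
    Tendsto (fun R : ℕ → M →L[𝕜] E => A fun j => R (i j) z) (iterFilter l 0 N)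
      (𝓝 (aronBernerVal n A fun _ => z')) := by
  -- Sorting injective indices makes them strictly increasing; symmetry of `A` absorbs the
  -- permutation.
  have hmono : StrictMono (i ∘ Tuple.sort i) :=
    (Tuple.monotone_sort i).strictMono_of_injective (hi.comp (Tuple.sort i).injective)
  refine (tendsto_iterFilter_aronBernerVal hl N n A (fun j => (i (Tuple.sort i j) : ℕ))
    (fun a b hab => hmono hab) fun j => (i _).2).congr fun R => ?_
  exact hA (Tuple.sort i) fun j => R (i j) z

/-- The average of the first `N` terms. -/
def average (N : ℕ) (R : ℕ → M →L[𝕜] E) : M →L[𝕜] E := (N : 𝕜)⁻¹ • ∑ i : Fin N, R i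

theorem norm_average_le {N : ℕ} {R : ℕ → M →L[𝕜] E} (hR : ∀ i < N, ‖R i‖ ≤ 1) :
    ‖average N R‖ ≤ 1 := by
  rw [average, norm_smul, norm_inv, RCLike.norm_natCast]
  have h : ‖∑ i : Fin N, R i‖ ≤ N := by
    simpa using (norm_sum_le Finset.univ _).trans (Finset.sum_le_sum fun (i : Fin N) _ => hR i i.2)
  calc _ ≤ (N : ℝ)⁻¹ * N := by gcongr
    _ ≤ 1 := inv_mul_le_one

theorem apply_average {n : ℕ} (A : E [×n]→L[𝕜] 𝕜) (N : ℕ) (R : ℕ → M →L[𝕜] E) (z : M) :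
    (A fun _ => average N R z) =
      ((N : 𝕜) ^ n)⁻¹ * ∑ i : Fin n → Fin N, A fun j => R (i j) z := by
  have h : (fun _ : Fin n => average N R z) =
      fun _ : Fin n => (N : 𝕜)⁻¹ • ∑ i : Fin N, R i z := by
    simp [average, _root_.sum_apply]
  rw [h, A.map_smul_univ (fun _ => (N : 𝕜)⁻¹) fun _ => ∑ i : Fin N, R i z, A.map_sum]
  simp

theorem card_filter_not_injective (n N : ℕ)
    [DecidablePred (Function.Injective : (Fin n → Fin N) → Prop)] :
    ((Finset.univ.filter fun i : Fin n → Fin N => ¬ Function.Injective i).card : ℝ) =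
      (N : ℝ) ^ n - N.descFactorial n := by
  have h1 : (Finset.univ.filter fun i : Fin n → Fin N => Function.Injective i).card =
      N.descFactorial n := by
    rw [← Fintype.card_subtype,
      Fintype.card_congr (Equiv.subtypeInjectiveEquivEmbedding (Fin n) (Fin N)),
      Fintype.card_embedding_eq, Fintype.card_fin, Fintype.card_fin]
  have h2 := Finset.card_filter_add_card_filter_not (s := Finset.univ)
    fun i : Fin n → Fin N => Function.Injective i
  rw [h1, Finset.card_univ, Fintype.card_fun, Fintype.card_fin, Fintype.card_fin] at h2
  rw [eq_sub_iff_add_eq, add_comm]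
  exact_mod_cast h2

/-- The `n`-linear expansion of the average is a mean over all index tuples. Injective tuples
converge to the Aron–Berner value along the iterated filter; the remaining terms are uniformly
bounded and their proportion `1 - N(N-1)⋯(N-n+1) / Nⁿ` vanishes as `N → ∞`. The filter does not
depend on `z`, so one filter serves all points. -/
theorem tendsto_average_aronBernerVal {l : Filter (M →L[𝕜] E)} (hl1 : ∀ᶠ R in l, ‖R‖ ≤ 1) {z : M}
    {z' : Bidual 𝕜 E}
    (hl : ∀ f : StrongDual 𝕜 E, Tendsto (fun R : M →L[𝕜] E => f (R z)) l (𝓝 (z' f)))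
    {n : ℕ} {A : E [×n]→L[𝕜] 𝕜}
    (hA : ∀ (τ : Equiv.Perm (Fin n)) (x : Fin n → E), A (fun j => x (τ j)) = A x) :
    Tendsto (fun T : M →L[𝕜] E => A fun _ => T z)
      ((atTop : Filter ℕ).bind fun N => (iterFilter l 0 N).map (average N))
      (𝓝 (aronBernerVal n A fun _ => z')) := by
  classical
  set c := aronBernerVal n A fun _ => z'
  set C : ℝ := ‖A‖ * ‖z‖ ^ n + ‖c‖
  have hC : 0 ≤ C := by positivity
  rw [Metric.tendsto_nhds]
  intro ε hε
  have hlim : Tendsto (fun N : ℕ => C * (1 - (N.descFactorial n : ℝ) / (N : ℝ) ^ n)) atTop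
      (𝓝 0) := by
    have h1 := (Asymptotics.isEquivalent_iff_tendsto_one (v := fun N : ℕ => (N : ℝ) ^ n)
      (by filter_upwards [eventually_gt_atTop 0] with N hN; positivity)).mp
      (isEquivalent_descFactorial n)
    simpa using (h1.const_sub 1).const_mul C
  rw [eventually_bind]
  filter_upwards [hlim.eventually (gt_mem_nhds (half_pos hε)), eventually_gt_atTop 0] with N hN hN0
  rw [eventually_map]
  -- For fixed `N` there are finitely many tuples, so all the limits are approximated
  -- simultaneously.
  have hinj : ∀ᶠ R in iterFilter l 0 N, ∀ i : Fin n → Fin N, Function.Injective i →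
      ‖(A fun j => R (i j) z) - c‖ ≤ ε / 2 := by
    refine eventually_all.mpr fun i => eventually_imp_distrib_left.mpr fun hi => ?_
    filter_upwards [Metric.tendsto_nhds.mp (tendsto_iterFilter_of_injective hl hA hi) (ε / 2)
      (half_pos hε)] with R hR
    rw [← dist_eq_norm]
    exact hR.le
  filter_upwards [hinj, eventually_iterFilter hl1 0 N] with R hR1 hR2
  have hN' : (0 : ℝ) < (N : ℝ) ^ n := by positivity
  have hNk : (N : 𝕜) ^ n ≠ 0 := pow_ne_zero _ (Nat.cast_ne_zero.mpr hN0.ne')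
  have hdiff : (A fun _ => average N R z) - c =
      ((N : 𝕜) ^ n)⁻¹ * ∑ i : Fin n → Fin N, ((A fun j => R (i j) z) - c) := by
    rw [apply_average, Finset.sum_sub_distrib, mul_sub]
    congr 1
    simp [hNk]
  have hbound : ∀ i : Fin n → Fin N, ‖(A fun j => R (i j) z) - c‖ ≤ C := by
    intro i
    refine (norm_sub_le _ _).trans (add_le_add_left ((A.le_opNorm _).trans ?_) _)
    gcongr
    calc ∏ j, ‖R (i j) z‖ ≤ ∏ _j : Fin n, ‖z‖ := by
          refine Finset.prod_le_prod (fun _ _ => norm_nonneg _) fun j _ => ?_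
          exact ((R (i j)).le_opNorm z).trans
            (mul_le_of_le_one_left (norm_nonneg _) (hR2 _ (i j).2))
      _ = ‖z‖ ^ n := by simp
  have hsum : ∑ i : Fin n → Fin N, ‖(A fun j => R (i j) z) - c‖ ≤
      (N : ℝ) ^ n * (ε / 2) + ((N : ℝ) ^ n - N.descFactorial n) * C := by
    rw [← Finset.sum_filter_add_sum_filter_not Finset.univ
      fun i : Fin n → Fin N => Function.Injective i]
    refine add_le_add ?_ ?_
    · refine (Finset.sum_le_card_nsmul _ _ (ε / 2) fun i hi =>
        hR1 i (Finset.mem_filter.mp hi).2).trans ?_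
      rw [nsmul_eq_mul]
      gcongr
      have := Finset.card_le_univ (Finset.univ.filter fun i : Fin n → Fin N => Function.Injective i)
      rw [Fintype.card_fun, Fintype.card_fin, Fintype.card_fin] at this
      exact_mod_cast this
    · refine (Finset.sum_le_card_nsmul _ _ C fun i _ => hbound i).trans ?_
      rw [nsmul_eq_mul, card_filter_not_injective]
  rw [dist_eq_norm, hdiff, norm_mul, norm_inv, norm_pow, RCLike.norm_natCast]
  calc ((N : ℝ) ^ n)⁻¹ * ‖∑ i : Fin n → Fin N, ((A fun j => R (i j) z) - c)‖
      ≤ ((N : ℝ) ^ n)⁻¹ * ((N : ℝ) ^ n * (ε / 2) + ((N : ℝ) ^ n - N.descFactorial n) * C) := by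
        gcongr
        exact (norm_sum_le _ _).trans hsum
    _ = ε / 2 + C * (1 - (N.descFactorial n : ℝ) / (N : ℝ) ^ n) := by
        field_simp
    _ < ε := by linarith

/-- On a finite dimensional space mapped contractively into `E''`, the Aron–Berner extension of
`P` is the pointwise limit of the polynomials `P ∘ T`, for contractions `T` into `E`. -/
theorem exists_filter_tendsto_aronBerner [FiniteDimensional 𝕜 M] (J : M →ₗ[𝕜] Bidual 𝕜 E)
    (hJ : ∀ z, ‖J z‖ ≤ ‖z‖) {n : ℕ} (P : HomPoly 𝕜 n E) :
    ∃ l : Filter (M →L[𝕜] E), l.NeBot ∧ (∀ᶠ T in l, ‖T‖ ≤ 1) ∧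
      ∀ z, Tendsto (fun T : M →L[𝕜] E => P.1 (T z)) l (𝓝 ((aronBerner P).1 (J z))) := by
  obtain ⟨l, hl0, hl1, hl2⟩ := exists_filter_contractions J hJ
  refine ⟨(atTop : Filter ℕ).bind fun N => (iterFilter l 0 N).map (average N),
    NeBot.bind inferInstance fun N => (iterFilter_neBot hl0 0 N).map _, ?_, fun z => ?_⟩
  · rw [eventually_bind]
    refine Eventually.of_forall fun N => eventually_map.mpr ?_
    exact (eventually_iterFilter hl1 0 N).mono fun R hR => norm_average_le hR
  · refine (tendsto_average_aronBernerVal hl1 (hl2 z) (HomPoly.symForm_perm P)).congr fun T => ?_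
    exact HomPoly.symForm_diag P (T z)

/-- Extending a variable and evaluating at a canonical image is just inserting the vector, one
variable at a time. -/
theorem aronBernerVal_inclusion : ∀ (n : ℕ) (A : E [×n]→L[𝕜] 𝕜) (x : Fin n → E),
    aronBernerVal n A (fun i => NormedSpace.inclusionInDoubleDual 𝕜 E (x i)) = A x
  | 0, A, x => congrArg A (Subsingleton.elim _ _)
  | n + 1, A, x => by
      refine (aronBernerVal_inclusion n ((NormedSpace.inclusionInDoubleDual 𝕜 E
        (x (Fin.last n))).compContinuousMultilinearMap A.curryRight) (Fin.init x)).trans ?_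
      change A (Fin.snoc (Fin.init x) (x (Fin.last n))) = A x
      rw [Fin.snoc_init_self]

/-- The Aron–Berner extension extends `P`. -/
theorem aronBerner_inclusion {n : ℕ} (P : HomPoly 𝕜 n E) (x : E) :
    (aronBerner P).1 (NormedSpace.inclusionInDoubleDual 𝕜 E x) = P.1 x :=
  (aronBernerVal_inclusion n (HomPoly.symForm P) fun _ => x).trans (HomPoly.symForm_diag P x)

end IteratedLimits


/-! ### Linearization of polynomials on the symmetric tensor product -/

section Linearization

variable {𝕜 : Type*} [RCLike 𝕜] {n : ℕ} {E F : Type*} [NormedAddCommGroup E] [NormedSpace 𝕜 E]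
  [NormedAddCommGroup F] [NormedSpace 𝕜 F]

theorem SymTensor.induction {p : SymTensor 𝕜 n E → Prop} (pow : ∀ x, p (tensorPow 𝕜 n x))
    (zero : p 0) (sum : ∀ z w, p z → p w → p (z + w)) (smul : ∀ (c : 𝕜) z, p z → p (c • z))
    (z : SymTensor 𝕜 n E) : p z := by
  obtain ⟨z, hz⟩ := z
  induction hz using Submodule.span_induction with
  | mem z hz =>
      obtain ⟨x, rfl⟩ := hz
      exact pow x
  | zero => exact zero
  | add z w hz hw ihz ihw => exact sum _ _ ihz ihw
  | smul c z hz ih => exact smul c _ ih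

theorem symTensorMap_tensorPow (T : E →L[𝕜] F) (x : E) :
    symTensorMap n T (tensorPow 𝕜 n x) = tensorPow 𝕜 n (T x) :=
  Subtype.ext (PiTensorProduct.map_tprod _ _)

/-- The linear functional on the symmetric tensor product with `x ⊗ ⋯ ⊗ x ↦ P x`. -/
def HomPoly.linearize (P : HomPoly 𝕜 n E) : SymTensor 𝕜 n E →ₗ[𝕜] 𝕜 :=
  (PiTensorProduct.lift (HomPoly.symForm P).toMultilinearMap).comp (SymTensor 𝕜 n E).subtype

theorem HomPoly.linearize_tensorPow (P : HomPoly 𝕜 n E) (x : E) :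
    HomPoly.linearize P (tensorPow 𝕜 n x) = P.1 x :=
  (PiTensorProduct.lift.tprod _).trans (HomPoly.symForm_diag P x)

/-- The powers span, so a functional is determined by its polynomial. -/
theorem HomPoly.eq_linearize (P : HomPoly 𝕜 n E) (ℓ : SymTensor 𝕜 n E →ₗ[𝕜] 𝕜)
    (h : ∀ x, ℓ (tensorPow 𝕜 n x) = P.1 x) : ℓ = HomPoly.linearize P := by
  ext z
  induction z using SymTensor.induction with
  | pow x => rw [h, HomPoly.linearize_tensorPow]
  | zero => rw [map_zero, map_zero]
  | sum z w hz hw => rw [map_add, map_add, hz, hw]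
  | smul c z hz => rw [map_smul, map_smul, hz]

theorem HomPoly.linearize_comp (P : HomPoly 𝕜 n E) (T : F →L[𝕜] E) (w : SymTensor 𝕜 n F) :
    HomPoly.linearize (HomPoly.comp P T) w = HomPoly.linearize P (symTensorMap n T w) := by
  refine (LinearMap.congr_fun (HomPoly.eq_linearize (HomPoly.comp P T)
    ((HomPoly.linearize P).comp (symTensorMap n T)) fun x => ?_) w).symm
  rw [LinearMap.comp_apply, symTensorMap_tensorPow, linearize_tensorPow]
  rfl

/-- Pointwise convergence of polynomials implies convergence of their linearizations. -/
theorem HomPoly.tendsto_linearize {ι : Type*} {l : Filter ι} {p : ι → HomPoly 𝕜 n E}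
    {P : HomPoly 𝕜 n E} (h : ∀ x, Tendsto (fun i => (p i).1 x) l (𝓝 (P.1 x)))
    (w : SymTensor 𝕜 n E) :
    Tendsto (fun i => HomPoly.linearize (p i) w) l (𝓝 (HomPoly.linearize P w)) := by
  induction w using SymTensor.induction with
  | pow x => simpa only [linearize_tensorPow] using h x
  | zero => simpa only [map_zero] using tendsto_const_nhds
  | sum z w hz hw => simpa only [map_add] using hz.add hw
  | smul c z hz => simpa only [map_smul] using hz.const_smul c

/-- Supplies the compactness by which bounded nets in `𝒬(M)` have limits inside `𝒬(M)`. -/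
theorem HomPoly.finiteDimensional [FiniteDimensional 𝕜 E] :
    FiniteDimensional 𝕜 (HomPoly 𝕜 n E) := by
  have : FiniteDimensional 𝕜 (E [×n]→L[𝕜] 𝕜) := FiniteDimensional.of_injective
    (ContinuousMultilinearMap.toMultilinearMapLinear :
      (E [×n]→L[𝕜] 𝕜) →ₗ[𝕜] MultilinearMap 𝕜 (fun _ : Fin n => E) 𝕜)
    ContinuousMultilinearMap.toMultilinearMap_injective
  unfold HomPoly
  infer_instance

end Linearization

/-! ### Duals of completed symmetric tensor products -/

namespace STensorNorm

variable {𝕜 : Type u} [RCLike 𝕜] {n : ℕ} {α : STensorNorm 𝕜 n} {E : Type u}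
  [NormedAddCommGroup E] [NormedSpace 𝕜 E] [CompleteSpace E]

/-- The inclusion of the symmetric tensor product into its completion. -/
def toCompletion (α : STensorNorm 𝕜 n) (E : Type u) [NormedAddCommGroup E] [NormedSpace 𝕜 E]
    [CompleteSpace E] : SymTensor 𝕜 n E →ₗ[𝕜] α.Completion E :=
  (UniformSpace.Completion.toComplL : α.Space E →L[𝕜] α.Completion E).toLinearMap

theorem norm_toCompletion (z : SymTensor 𝕜 n E) : ‖α.toCompletion E z‖ = α.norm E z :=
  UniformSpace.Completion.norm_coe (E := α.Space E) z

theorem denseRange_toCompletion : DenseRange (α.toCompletion E) :=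
  UniformSpace.Completion.denseRange_coe (α := α.Space E)

theorem apply_toCompletion (φ : StrongDual 𝕜 (α.Completion E)) (z : SymTensor 𝕜 n E) :
    φ (α.toCompletion E z) = HomPoly.linearize (toPoly φ) z :=
  LinearMap.congr_fun
    (HomPoly.eq_linearize (toPoly φ) (φ.toLinearMap.comp (α.toCompletion E)) fun _ => rfl) z

theorem norm_linearize_le (φ : StrongDual 𝕜 (α.Completion E)) (z : SymTensor 𝕜 n E) :
    ‖HomPoly.linearize (toPoly φ) z‖ ≤ ‖φ‖ * α.norm E z := by
  rw [← apply_toCompletion, ← norm_toCompletion]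
  exact φ.le_opNorm _

theorem norm_le_of_linearize_le {φ : StrongDual 𝕜 (α.Completion E)} {C : ℝ} (hC : 0 ≤ C)
    (h : ∀ z, ‖HomPoly.linearize (toPoly φ) z‖ ≤ C * α.norm E z) : ‖φ‖ ≤ C := by
  refine φ.opNorm_le_bound hC fun y => ?_
  refine denseRange_toCompletion.induction_on (p := fun y => ‖φ y‖ ≤ C * ‖y‖) y
    (isClosed_le (by fun_prop) (by fun_prop)) fun z => ?_
  rw [apply_toCompletion, norm_toCompletion]
  exact h z

/-- A polynomial whose linearization is bounded for `α` belongs to the dual. -/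
theorem exists_toPoly_eq {P : HomPoly 𝕜 n E} {C : ℝ}
    (h : ∀ z, ‖HomPoly.linearize P z‖ ≤ C * α.norm E z) :
    ∃ ψ : StrongDual 𝕜 (α.Completion E), toPoly ψ = P := by
  refine ⟨(HomPoly.linearize P).extendOfNorm (α.toCompletion E), Subtype.ext (funext fun x => ?_)⟩
  -- Density together with the bound `C` guarantees that `extendOfNorm` really extends the
  -- linearization.
  have h1 := LinearMap.extendOfNorm_eq (f := HomPoly.linearize P) (e := α.toCompletion E)
    denseRange_toCompletion ⟨C, fun z => by rw [norm_toCompletion]; exact h z⟩ (tensorPow 𝕜 n x)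
  rw [HomPoly.linearize_tensorPow] at h1
  exact h1

/-- If `Q` on `G` is the composition of the Aron–Berner extension with a contraction `G → E''`,
then its linearization is bounded by the norm of the given functional. -/
theorem norm_linearize_le_of_eq_aronBerner (hα : α.FinitelyGenerated)
    (φ : StrongDual 𝕜 (α.Completion E)) {G : Type u} [NormedAddCommGroup G] [NormedSpace 𝕜 G]
    [CompleteSpace G] (J : G →ₗ[𝕜] Bidual 𝕜 E) (hJ : ∀ x, ‖J x‖ ≤ ‖x‖) {Q : HomPoly 𝕜 n G}
    (hQ : ∀ x, Q.1 x = (aronBerner (toPoly φ)).1 (J x)) (z : SymTensor 𝕜 n G) :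
    ‖HomPoly.linearize Q z‖ ≤ ‖φ‖ * α.norm G z := by
  have key : ∀ (M : Submodule 𝕜 G) (_ : FiniteDimensional 𝕜 M) (w : SymTensor 𝕜 n M),
      symTensorMap n M.subtypeL w = z → ‖HomPoly.linearize Q z‖ ≤
        ‖φ‖ * (haveI := FiniteDimensional.complete 𝕜 M; α.norm M w) := by
    intro M _ w hw
    have := FiniteDimensional.complete 𝕜 M
    obtain ⟨l, hl0, hl1, hl2⟩ := exists_filter_tendsto_aronBerner (J.comp M.subtype)
      (fun x => hJ x) (toPoly φ)
    have hlim := HomPoly.tendsto_linearize (p := fun T : M →L[𝕜] E => HomPoly.comp (toPoly φ) T)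
      (P := HomPoly.comp Q M.subtypeL) (l := l) (fun x => by
        have h := hl2 x
        rw [LinearMap.comp_apply, ← hQ] at h
        exact h) w
    rw [HomPoly.linearize_comp, hw] at hlim
    -- Each `P ∘ T` satisfies the bound on `w`, by the mapping property for the contraction `T`; the
    -- limit inherits it.
    refine le_of_tendsto hlim.norm (hl1.mono fun T hT => ?_)
    rw [HomPoly.linearize_comp]
    refine (norm_linearize_le φ _).trans ?_
    gcongr
    refine (α.norm_map_le M E T w).trans (mul_le_of_le_one_left (apply_nonneg _ _) ?_)
    exact pow_le_one₀ (norm_nonneg _) hT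
  refine le_of_forall_pos_le_add fun δ hδ => ?_
  -- This tolerance keeps the error `‖φ‖ · δ / (‖φ‖ + 1)` below `δ`, also when `φ = 0`.
  have hpos : 0 < δ / (‖φ‖ + 1) := by positivity
  obtain ⟨_, ⟨M, hM, w, hw, rfl⟩, -, hr⟩ := (hα G z).exists_between
    (lt_add_of_pos_right _ hpos)
  refine (key M hM w hw).trans ((mul_le_mul_of_nonneg_left hr.le (norm_nonneg φ)).trans ?_)
  rw [mul_add]
  gcongr
  rw [mul_div_assoc', div_le_iff₀ (by positivity)]
  nlinarith

/-- The bound on finite-dimensional pieces with `J = id` yields `ψ` and `‖ψ‖ ≤ ‖φ‖`. Conversely, `φ`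
corresponds to the restriction of `ψ` along the contraction `E → E''`, so the mapping property gives
`‖φ‖ ≤ ‖ψ‖`. -/
theorem exists_toPoly_eq_aronBerner (hα : α.FinitelyGenerated)
    (φ : StrongDual 𝕜 (α.Completion E)) :
    ∃ ψ : StrongDual 𝕜 (α.Completion (Bidual 𝕜 E)),
      toPoly ψ = aronBerner (toPoly φ) ∧ ‖φ‖ = ‖ψ‖ := by
  have hAB := norm_linearize_le_of_eq_aronBerner hα φ (G := Bidual 𝕜 E) LinearMap.id
    (fun _ => le_rfl) (Q := aronBerner (toPoly φ)) fun _ => rfl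
  obtain ⟨ψ, hψ⟩ := exists_toPoly_eq hAB
  refine ⟨ψ, hψ, le_antisymm ?_ ?_⟩
  · refine norm_le_of_linearize_le (norm_nonneg ψ) fun w => ?_
    have h1 : toPoly φ = HomPoly.comp (toPoly ψ) (NormedSpace.inclusionInDoubleDual 𝕜 E) := by
      rw [hψ]
      exact Subtype.ext (funext fun x => (aronBerner_inclusion _ x).symm)
    rw [h1, HomPoly.linearize_comp]
    refine (norm_linearize_le ψ _).trans ?_
    gcongr
    refine (α.norm_map_le E (Bidual 𝕜 E) _ w).trans
      (mul_le_of_le_one_left (apply_nonneg _ _) ?_)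
    exact pow_le_one₀ (norm_nonneg _) (NormedSpace.inclusionInDoubleDual_norm_le 𝕜 E)
  · exact norm_le_of_linearize_le (norm_nonneg φ) (by rwa [hψ])

end STensorNorm

/-! ### Maximal ideals -/

/-- A net bounded for a norm on a finite dimensional space has a weakly convergent subnet whose
limit satisfies the same bound. -/
theorem Seminorm.exists_weak_limit {𝕜 V ι : Type*} [RCLike 𝕜] [AddCommGroup V] [Module 𝕜 V]
    [FiniteDimensional 𝕜 V] (N : Seminorm 𝕜 V) (hN : ∀ v, N v = 0 → v = 0) {l : Filter ι}
    [l.NeBot] {p : ι → V} {C : ℝ} (hp : ∀ᶠ i in l, N (p i) ≤ C) :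
    ∃ q, N q ≤ C ∧ ∃ l' : Filter ι, l'.NeBot ∧ l' ≤ l ∧
      ∀ ℓ : V →ₗ[𝕜] 𝕜, Tendsto (fun i => ℓ (p i)) l' (𝓝 (ℓ q)) := by
  let _ : NormedAddCommGroup V := AddGroupNorm.toNormedAddCommGroup
    { toFun := N
      map_zero' := map_zero N
      add_le' := map_add_le_add N
      neg' := map_neg_eq_map N
      eq_zero_of_map_eq_zero' := hN }
  let _ : NormedSpace 𝕜 V := { norm_smul_le c v := (map_smul_eq_mul N c v).le }
  have : ProperSpace V := FiniteDimensional.proper 𝕜 V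
  have hnorm : ∀ v : V, ‖v‖ = N v := fun _ => rfl
  -- An ultrafilter finer than `l` converges in the compact ball of radius `C`, and all linear
  -- functionals are continuous.
  obtain ⟨q, hq, hlim⟩ := (isCompact_closedBall (0 : V) C).ultrafilter_le_nhds
    ((Ultrafilter.of l).map p) (by
      rw [le_principal_iff]
      exact Ultrafilter.of_le l (hp.mono fun i hi => by
        rw [mem_closedBall_zero_iff, hnorm]; exact hi))
  refine ⟨q, by simpa [hnorm] using hq, Ultrafilter.of l, inferInstance, Ultrafilter.of_le l,
    fun ℓ => ?_⟩
  exact (ℓ.continuous_of_finiteDimensional.tendsto q).comp hlim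

namespace PolyIdeal

variable {𝕜 : Type u} [RCLike 𝕜] {n : ℕ} {𝒬 : PolyIdeal 𝕜 n} {E : Type u}
  [NormedAddCommGroup E] [NormedSpace 𝕜 E] [CompleteSpace E]

theorem extNorm_of_mem {P : HomPoly 𝕜 n E} (hP : P ∈ 𝒬.space E) :
    𝒬.extNorm P = ENNReal.ofReal (𝒬.norm E ⟨P, hP⟩) := dif_pos hP

theorem mem_and_norm_le_of_extNorm_le {P : HomPoly 𝕜 n E} {C : ℝ} (hC : 0 ≤ C)
    (h : 𝒬.extNorm P ≤ ENNReal.ofReal C) :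
    ∃ hP : P ∈ 𝒬.space E, 𝒬.norm E ⟨P, hP⟩ ≤ C := by
  by_cases hP : P ∈ 𝒬.space E
  · rw [extNorm_of_mem hP] at h
    exact ⟨hP, (ENNReal.ofReal_le_ofReal_iff hC).mp h⟩
  · rw [extNorm, dif_neg hP, top_le_iff] at h
    exact absurd h ENNReal.ofReal_ne_top

/-- The polynomials `P ∘ T` stay in the ball of radius `‖P‖` of the finite-dimensional space `𝒬(M)`.
They therefore have a limit point in that ball, which must agree with their pointwise limit `Q|_M`.
-/
theorem extNorm_restrict_le_of_eq_aronBerner {P : HomPoly 𝕜 n E} (hP : P ∈ 𝒬.space E)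
    {G : Type u} [NormedAddCommGroup G] [NormedSpace 𝕜 G] (J : G →ₗ[𝕜] Bidual 𝕜 E)
    (hJ : ∀ x, ‖J x‖ ≤ ‖x‖) {Q : HomPoly 𝕜 n G} (hQ : ∀ x, Q.1 x = (aronBerner P).1 (J x))
    (M : Submodule 𝕜 G) [FiniteDimensional 𝕜 M] [CompleteSpace M] :
    𝒬.extNorm (HomPoly.comp Q M.subtypeL) ≤ ENNReal.ofReal (𝒬.norm E ⟨P, hP⟩) := by
  obtain ⟨l, hl0, hl1, hl2⟩ := exists_filter_tendsto_aronBerner (J.comp M.subtype)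
    (fun x => hJ x) P
  have : FiniteDimensional 𝕜 (HomPoly 𝕜 n M) := HomPoly.finiteDimensional
  obtain ⟨q, hq, l', hl'0, hl'l, hlim⟩ := (𝒬.norm M).exists_weak_limit
    (𝒬.eq_zero_of_norm_eq_zero M) (l := l)
    (p := fun T => ⟨HomPoly.comp P T, 𝒬.comp_mem E M T P hP⟩) (C := 𝒬.norm E ⟨P, hP⟩)
    (hl1.mono fun T hT => (𝒬.norm_comp_le E M T P hP).trans
      (mul_le_of_le_one_right (apply_nonneg _ _) (pow_le_one₀ (norm_nonneg _) hT)))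
  have hqP : HomPoly.comp Q M.subtypeL = q.1 := by
    refine Subtype.ext (funext fun z => ?_)
    refine (hQ z).trans ?_
    -- Evaluation at `z` is a linear functional on `𝒬(M)`, so weak convergence to `q` implies
    -- pointwise convergence.
    exact tendsto_nhds_unique ((hl2 z).mono_left hl'l)
      (hlim ((LinearMap.proj z).comp ((HomPoly 𝕜 n M).subtype.comp (𝒬.space M).subtype)))
  rw [hqP, extNorm_of_mem q.2]
  exact ENNReal.ofReal_le_ofReal hq

theorem extNorm_le_of_eq_aronBerner (h𝒬 : 𝒬.IsMaximal) {P : HomPoly 𝕜 n E}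
    (hP : P ∈ 𝒬.space E) {G : Type u} [NormedAddCommGroup G] [NormedSpace 𝕜 G] [CompleteSpace G]
    (J : G →ₗ[𝕜] Bidual 𝕜 E) (hJ : ∀ x, ‖J x‖ ≤ ‖x‖) {Q : HomPoly 𝕜 n G}
    (hQ : ∀ x, Q.1 x = (aronBerner P).1 (J x)) :
    𝒬.extNorm Q ≤ ENNReal.ofReal (𝒬.norm E ⟨P, hP⟩) := by
  rw [h𝒬 G Q]
  refine iSup₂_le fun M hM => ?_
  have := FiniteDimensional.complete 𝕜 M
  exact extNorm_restrict_le_of_eq_aronBerner hP J hJ hQ M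

/-- The estimate with `J = id` gives membership and one inequality, a finite extended norm forcing
membership. The other is the ideal property for the canonical embedding, along which `AB(P)`
restricts to `P`. -/
theorem exists_aronBerner_mem (h𝒬 : 𝒬.IsMaximal) {P : HomPoly 𝕜 n E} (hP : P ∈ 𝒬.space E) :
    ∃ hAB : aronBerner P ∈ 𝒬.space (Bidual 𝕜 E),
      𝒬.norm E ⟨P, hP⟩ = 𝒬.norm (Bidual 𝕜 E) ⟨aronBerner P, hAB⟩ := by
  have hle : 𝒬.extNorm (aronBerner P) ≤ ENNReal.ofReal (𝒬.norm E ⟨P, hP⟩) :=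
    extNorm_le_of_eq_aronBerner h𝒬 hP (G := Bidual 𝕜 E) LinearMap.id (fun _ => le_rfl)
      fun _ => rfl
  obtain ⟨hAB, hnorm⟩ := mem_and_norm_le_of_extNorm_le (apply_nonneg _ _) hle
  refine ⟨hAB, le_antisymm ?_ hnorm⟩
  have h1 : HomPoly.comp (aronBerner P) (NormedSpace.inclusionInDoubleDual 𝕜 E) = P :=
    Subtype.ext (funext fun x => aronBerner_inclusion P x)
  have h2 := 𝒬.norm_comp_le (Bidual 𝕜 E) E (NormedSpace.inclusionInDoubleDual 𝕜 E)
    (aronBerner P) hAB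
  simp only [h1] at h2
  refine h2.trans (mul_le_of_le_one_right (apply_nonneg _ _) (pow_le_one₀ (norm_nonneg _) ?_))
  exact NormedSpace.inclusionInDoubleDual_norm_le 𝕜 E

end PolyIdeal

end

theorem corollary3p4 {𝕜 : Type u} [RCLike 𝕜] (n : ℕ)
    (E : Type u) [NormedAddCommGroup E] [NormedSpace 𝕜 E] [CompleteSpace E] :
    (∀ α : STensorNorm 𝕜 n, α.FinitelyGenerated →
      ∀ φ : StrongDual 𝕜 (α.Completion E),
        ∃ ψ : StrongDual 𝕜 (α.Completion (Bidual 𝕜 E)),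
          STensorNorm.toPoly ψ = aronBerner (STensorNorm.toPoly φ) ∧ ‖φ‖ = ‖ψ‖) ∧
    (∀ 𝒬 : PolyIdeal 𝕜 n, 𝒬.IsMaximal →
      ∀ (P : HomPoly 𝕜 n E) (hP : P ∈ 𝒬.space E),
        ∃ hAB : aronBerner P ∈ 𝒬.space (Bidual 𝕜 E),
          𝒬.norm E ⟨P, hP⟩ = 𝒬.norm (Bidual 𝕜 E) ⟨aronBerner P, hAB⟩) := by
  exact ⟨fun _ hα φ => STensorNorm.exists_toPoly_eq_aronBerner hα φ,
    fun _ h𝒬 _ hP => PolyIdeal.exists_aronBerner_mem h𝒬 hP⟩
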